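/- **Proposition (Covariant derivative of the duality coupling).** Let $(\Omega,\mathcal F,\mu)$ be a $\sigma$-finite measure space and let $\mathcal P_>$ be the set of $\mu$-a.s. strictly positive probability densities. For $p\in\mathcal P_>$ write $\mathbb E_p[f]=\int f\,p\,d\mu$. Let $\Phi(y)=\cosh y-1$ and $\Phi_*(x)=x\sinh^{-1}x-\sqrt{1+x^2}+1$ be the conjugate Young pair. Let $L^{\Phi}(p)$, $L^{\Phi_*}(p)$ be the corresponding Orlicz spaces with their Luxemburg norms, and put $$B_p=\{u\in L^{\Phi}(p):\mathbb E_p[u]=0\},\qquad {}^*B_p=\{v\in L^{\Phi_*}(p):\mathbb E_p[v]=0\}.$$ Let $K_p(u)=\log\mathbb E_p[e^u]$ for $u\in B_p$, let $\mathcal S_p$ be the interior in $B_p$ of $\{K_p<+\infty\}$, let $e_p(u)=e^{u-K_p(u)}p$ for $u\in\mathcal S_p$, and let $\mathcal E(p)=e_p(\mathcal S_p)$ be the maximal exponential model at $p$, with chart $s_p=e_p^{-1}\colon q\mapsto\log\frac qp-\mathbb E_p\big[\log\frac qp\big]$. For $q\in\mathcal E(p)$ define the transports $$\mathbb U_p^q\colon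 B_p\to B_q,\ v\mapsto v-\mathbb E_q[v],\qquad {}^*\mathbb U_p^q\colon {}^*B_p\to{}^*B_q,\ v\mapsto \tfrac pq\,v .$$ Let $\mathcal E=\mathcal E(p_0)$ be a maximal exponential model. A vector field of the tangent (resp. pretangent) bundle on $\mathcal E$ is a map $F$ with $F(q)\in B_q$ (resp. $F(q)\in{}^*B_q$) for $q\in\mathcal E$. Its representation in the chart at $p\in\mathcal E$ is $F_p(u)=\mathbb U_{e_p(u)}^p F(e_p(u))$ (resp. $F_p(u)={}^*\mathbb U_{e_p(u)}^pF(e_p(u))$), $u\in\mathcal S_p$; a real function $E$ on $\mathcal E$ is represented by $E_p=E\circ e_p$. Such an object is of class $C^1$ on $\mathcal E$ if its representation in the chart at every $p\in\mathcal E$ is $C^1$ on $\mathcal S_p$. Given a vector field $H$ of the tangent bundle, the covariant derivatives along $H$ are defined, for $q\in\mathcal E$, as follows: * for a $C^1$ function $E$, using any $p\in\mathcal E$: $D_HE(q)=dE_p(s_p(q))\,\mathbb U_q^pH(q)\in\mathbb R$; * for a $C^1$ field $G$ of the tangent bundle, using any $p\in\mathcal E$: $D_HG(q)=\mathbb U_p^q\,dG_p(s_p(q))\,\mathbb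 U_q^pH(q)\in B_q$; * for a $C^1$ field $F$ of the pretangent bundle: $D_HF(q)=dF_q(0)\,H(q)\in{}^*B_q$. The duality coupling is $\langle v,w\rangle_q=\mathbb E_q[vw]$ for $v\in{}^*B_q$, $w\in B_q$, and $\langle F,G\rangle$ denotes the function $q\mapsto\langle F(q),G(q)\rangle_q$. Let $F$ be a vector field of the pretangent bundle and $G,H$ vector fields of the tangent bundle, all of class $C^1$ on $\mathcal E$. Then $\langle F,G\rangle$ is of class $C^1$ on $\mathcal E$, and at every $q\in\mathcal E$ $$D_H\langle F,G\rangle(q)=\langle D_HF(q),G(q)\rangle_q+\langle F(q),D_HG(q)\rangle_q ,$$ whichever charts $p,r\in\mathcal E$ are used to compute $D_H\langle F,G\rangle(q)$ and $D_HG(q)$. -/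

import Mathlib

open MeasureTheory Set
open scoped ENNReal

namespace ExpManifold

/-! ### Young functions -/

/-- A (finite-valued) Young function: even, convex, vanishing exactly at `0`. -/
structure YoungFunction where
  toFun : ℝ → ℝ
  even : ∀ x, toFun (-x) = toFun x
  convex : ConvexOn ℝ univ toFun
  map_zero : toFun 0 = 0
  pos : ∀ x, x ≠ 0 → 0 < toFun x

instance : CoeFun YoungFunction (fun _ => ℝ → ℝ) := ⟨YoungFunction.toFun⟩

namespace YoungFunction

variable (Φ : YoungFunction)

theorem nonneg (x : ℝ) : 0 ≤ Φ x := by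
  by_cases h : x = 0
  · rw [h, Φ.map_zero]
  · exact (Φ.pos x h).le

theorem continuous : Continuous Φ := by
  rw [← continuousOn_univ]
  exact Φ.convex.continuousOn isOpen_univ

theorem map_smul_le {t : ℝ} (h0 : 0 ≤ t) (h1 : t ≤ 1) (x : ℝ) : Φ (t * x) ≤ t * Φ x := by
  have h := Φ.convex.2 (mem_univ x) (mem_univ (0 : ℝ)) h0 (sub_nonneg.2 h1) (by ring)
  simpa [Φ.map_zero] using h

theorem map_comb_le {a b : ℝ} (ha : 0 ≤ a) (hb : 0 ≤ b) (hab : a + b = 1) (x y : ℝ) :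
    Φ (a * x + b * y) ≤ a * Φ x + b * Φ y := by
  simpa using Φ.convex.2 (mem_univ x) (mem_univ y) ha hb hab

theorem map_abs (x : ℝ) : Φ |x| = Φ x := by
  rcases abs_choice x with h | h <;> rw [h]
  exact Φ.even x

theorem mul_abs_le (x : ℝ) : Φ 1 * |x| ≤ Φ 1 + Φ x := by
  have h1 := Φ.pos 1 one_ne_zero
  by_cases hx : |x| ≤ 1
  · nlinarith [Φ.nonneg x]
  · have hx' : 1 < |x| := not_le.1 hx
    have hpos : 0 < |x| := by linarith
    have h := Φ.map_smul_le (inv_nonneg.2 hpos.le) (inv_le_one_of_one_le₀ hx'.le) |x|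
    rw [inv_mul_cancel₀ hpos.ne', Φ.map_abs, inv_mul_eq_div, le_div_iff₀ hpos] at h
    linarith

end YoungFunction

/-- `Φ(y) = cosh y - 1`. -/
noncomputable def coshYoung : YoungFunction where
  toFun y := Real.cosh y - 1
  even x := by simp
  convex := by
    refine Monotone.convexOn_univ_of_deriv (Real.differentiable_cosh.sub_const 1) ?_
    have : deriv (fun y => Real.cosh y - 1) = Real.sinh := by
      ext y; simp
    rw [this]
    exact Real.sinh_strictMono.monotone
  map_zero := by simp
  pos x hx := by
    have := Real.one_lt_cosh.2 hx
    linarith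

/-- The conjugate Young function `Φ_*(x) = x arsinh x - √(1 + x²) + 1 = ∫₀^{|x|} arsinh`. -/
noncomputable def coshYoungConj : YoungFunction where
  toFun x := x * Real.arsinh x - √(1 + x ^ 2) + 1
  even x := by simp
  convex := by
    have hd : ∀ x : ℝ, HasDerivAt (fun x => x * Real.arsinh x - √(1 + x ^ 2) + 1)
        (Real.arsinh x) x := by
      intro x
      have hp : (1 + x ^ 2) ≠ 0 := by positivity
      have h2 : HasDerivAt (fun x : ℝ => 1 + x ^ 2) (2 * x) x := by
        simpa using (hasDerivAt_pow 2 x).const_add 1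
      have h := (((hasDerivAt_id x).mul (Real.hasDerivAt_arsinh x)).sub
        (h2.sqrt hp)).add_const 1
      refine h.congr_deriv ?_
      simp only [id]
      field_simp
      ring
    refine Monotone.convexOn_univ_of_deriv (fun x => (hd x).differentiableAt) ?_
    have : deriv (fun x => x * Real.arsinh x - √(1 + x ^ 2) + 1) = Real.arsinh := by
      ext x; exact (hd x).deriv
    rw [this]
    exact Real.arsinh_strictMono.monotone
  map_zero := by simp
  pos x hx := by
    obtain ⟨y, rfl⟩ := Real.sinh_surjective x
    have hy : y ≠ 0 := by rintro rfl; simp at hx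
    rw [Real.arsinh_sinh, ← Real.cosh_sq', Real.sqrt_sq (Real.cosh_pos y).le]
    have key : ∀ z : ℝ, 0 < z → 0 < Real.sinh z * z - Real.cosh z + 1 := by
      intro z hz
      have hm : StrictMonoOn (fun z : ℝ => Real.sinh z * z - Real.cosh z + 1) (Ici 0) := by
        refine strictMonoOn_of_deriv_pos (convex_Ici 0) (by fun_prop) ?_
        intro w hw
        rw [interior_Ici] at hw
        have : HasDerivAt (fun z : ℝ => Real.sinh z * z - Real.cosh z + 1)
            (Real.cosh w * w) w := by
          have h := (((Real.hasDerivAt_sinh w).mul (hasDerivAt_id w)).sub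
            (Real.hasDerivAt_cosh w)).add_const 1
          refine h.congr_deriv ?_
          simp
        rw [this.deriv]
        exact mul_pos (Real.cosh_pos w) hw
      have := hm (mem_Ici.2 le_rfl) (mem_Ici.2 hz.le) hz
      simpa using this
    rcases lt_or_gt_of_ne hy with h | h
    · have := key (-y) (by linarith)
      simpa using this
    · exact key y h

/-! ### Positive densities and expectations -/

variable {Ω : Type*} [MeasurableSpace Ω] {μ : Measure Ω}

/-- `𝒫_>`: the (classes of) `μ`-a.e. strictly positive probability densities. -/
structure PosDensity (μ : Measure Ω) where
  toAEEqFun : Ω →ₘ[μ] ℝ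
  pos : ∀ᵐ x ∂μ, 0 < toAEEqFun x
  lintegral_eq_one : ∫⁻ x, ENNReal.ofReal (toAEEqFun x) ∂μ = 1

noncomputable instance : CoeFun (PosDensity μ) (fun _ => Ω → ℝ) := ⟨fun p => p.toAEEqFun⟩

namespace PosDensity

variable (p : PosDensity μ)

/-- `E_p[f]` for a nonnegative `f`, with values in `[0, ∞]`. -/
noncomputable def lexpect (f : Ω → ℝ) : ℝ≥0∞ :=
  ∫⁻ x, ENNReal.ofReal (f x) * ENNReal.ofReal (p x) ∂μ

/-- `E_p[f] = ∫ f p dμ`. -/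
noncomputable def expect (f : Ω → ℝ) : ℝ := ∫ x, f x * p x ∂μ

theorem aemeasurable : AEMeasurable p μ := p.toAEEqFun.aemeasurable

theorem integrable : Integrable p μ := by
  refine ⟨p.toAEEqFun.aestronglyMeasurable, ?_⟩
  rw [hasFiniteIntegral_iff_ofReal (p.pos.mono fun x hx => hx.le), p.lintegral_eq_one]
  exact ENNReal.one_lt_top

theorem expect_one : p.expect (fun _ => 1) = 1 := by
  simp only [expect, one_mul]
  rw [integral_eq_lintegral_of_nonneg_ae (p.pos.mono fun x hx => hx.le)
    p.toAEEqFun.aestronglyMeasurable, p.lintegral_eq_one]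
  simp

theorem lexpect_congr {f g : Ω → ℝ} (h : f =ᵐ[μ] g) : p.lexpect f = p.lexpect g := by
  refine lintegral_congr_ae ?_
  filter_upwards [h] with x hx
  rw [hx]

theorem expect_congr {f g : Ω → ℝ} (h : f =ᵐ[μ] g) : p.expect f = p.expect g := by
  refine integral_congr_ae ?_
  filter_upwards [h] with x hx
  simp only [hx]

theorem lexpect_mono {f g : Ω → ℝ} (h : ∀ x, f x ≤ g x) : p.lexpect f ≤ p.lexpect g := by
  refine lintegral_mono fun x => ?_
  gcongr
  exact h x

theorem lexpect_comb {f g : Ω → ℝ} (hf : AEMeasurable f μ) (hf0 : ∀ x, 0 ≤ f x)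
    (hg0 : ∀ x, 0 ≤ g x) {a b : ℝ} (ha : 0 ≤ a) (hb : 0 ≤ b) :
    p.lexpect (fun x => a * f x + b * g x)
      = ENNReal.ofReal a * p.lexpect f + ENNReal.ofReal b * p.lexpect g := by
  unfold lexpect
  have hm : AEMeasurable (fun x => ENNReal.ofReal (f x) * ENNReal.ofReal (p x)) μ :=
    hf.ennreal_ofReal.mul p.aemeasurable.ennreal_ofReal
  rw [← lintegral_const_mul' _ _ ENNReal.ofReal_ne_top,
    ← lintegral_const_mul' _ _ ENNReal.ofReal_ne_top,
    ← lintegral_add_left' (hm.const_mul _)]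
  refine lintegral_congr fun x => ?_
  rw [ENNReal.ofReal_add (mul_nonneg ha (hf0 x)) (mul_nonneg hb (hg0 x)),
    ENNReal.ofReal_mul ha, ENNReal.ofReal_mul hb]
  ring

theorem lexpect_smul {f : Ω → ℝ} {a : ℝ} (ha : 0 ≤ a) :
    p.lexpect (fun x => a * f x) = ENNReal.ofReal a * p.lexpect f := by
  unfold lexpect
  rw [← lintegral_const_mul' _ _ ENNReal.ofReal_ne_top]
  refine lintegral_congr fun x => ?_
  rw [ENNReal.ofReal_mul ha]
  ring

end PosDensity

/-! ### Orlicz spaces with the Luxemburg norm -/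

section Orlicz

variable (Φ : YoungFunction) (p : PosDensity μ)

theorem modular_comb_le (f g : Ω →ₘ[μ] ℝ) {a b : ℝ} (ha : 0 ≤ a) (hb : 0 ≤ b)
    (hab : a + b = 1) (s t : ℝ) :
    p.lexpect (fun x => Φ (a * (s * f x) + b * (t * g x)))
      ≤ ENNReal.ofReal a * p.lexpect (fun x => Φ (s * f x))
        + ENNReal.ofReal b * p.lexpect (fun x => Φ (t * g x)) := by
  have hm : AEMeasurable (fun x => Φ (s * f x)) μ :=
    Φ.continuous.measurable.comp_aemeasurable (f.aemeasurable.const_mul s)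
  rw [← p.lexpect_comb hm (fun _ => Φ.nonneg _) (fun _ => Φ.nonneg _) ha hb]
  exact p.lexpect_mono fun x => Φ.map_comb_le ha hb hab _ _

theorem modular_smul_le (f : Ω →ₘ[μ] ℝ) {t : ℝ} (h0 : 0 ≤ t) (h1 : t ≤ 1) (s : ℝ) :
    p.lexpect (fun x => Φ (t * (s * f x)))
      ≤ ENNReal.ofReal t * p.lexpect (fun x => Φ (s * f x)) := by
  rw [← p.lexpect_smul h0]
  exact p.lexpect_mono fun x => Φ.map_smul_le h0 h1 _

/-- The Orlicz space `L^Φ(p)`: all `f` with `E_p[Φ(α f)] < ∞` for some `α > 0`. -/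
noncomputable def orlicz : Submodule ℝ (Ω →ₘ[μ] ℝ) where
  carrier := {f | ∃ α : ℝ, 0 < α ∧ p.lexpect (fun x => Φ (α * f x)) < ∞}
  zero_mem' := by
    refine ⟨1, one_pos, ?_⟩
    rw [p.lexpect_congr (g := fun _ => 0)]
    · simp [PosDensity.lexpect]
    · filter_upwards [AEEqFun.coeFn_zero (α := Ω) (β := ℝ) (μ := μ)] with x hx
      simp [hx, Φ.map_zero]
  add_mem' := by
    rintro f g ⟨α, hα, hf⟩ ⟨β, hβ, hg⟩
    have hs : 0 < α + β := add_pos hα hβ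
    refine ⟨α * β / (α + β), by positivity, ?_⟩
    refine lt_of_le_of_lt (le_of_eq_of_le (p.lexpect_congr ?_)
      (modular_comb_le Φ p f g (a := β / (α + β)) (b := α / (α + β)) (by positivity)
        (by positivity) (by field_simp; ring) α β)) ?_
    · filter_upwards [AEEqFun.coeFn_add f g] with x hx
      rw [hx, Pi.add_apply]
      congr 1
      field_simp
    · exact ENNReal.add_lt_top.2 ⟨ENNReal.mul_lt_top ENNReal.ofReal_lt_top hf,
        ENNReal.mul_lt_top ENNReal.ofReal_lt_top hg⟩
  smul_mem' := by
    rintro c f ⟨α, hα, hf⟩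
    refine ⟨α / (|c| + 1), by positivity, ?_⟩
    refine lt_of_le_of_lt (le_of_eq_of_le (p.lexpect_congr ?_)
      (modular_smul_le Φ p f (t := |c| / (|c| + 1)) (by positivity)
        ((div_le_one (by positivity)).2 (by linarith)) α)) ?_
    · filter_upwards [AEEqFun.coeFn_smul c f] with x hx
      rw [hx, Pi.smul_apply, smul_eq_mul, ← Φ.map_abs, ← Φ.map_abs (_ * (_ * _))]
      congr 1
      simp only [abs_mul, abs_div, abs_abs]
      ring
    · exact ENNReal.mul_lt_top ENNReal.ofReal_lt_top hf

variable {Φ p}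

/-- The radii `r > 0` with `E_p[Φ(f / r)] ≤ 1`. -/
def luxRadii (f : orlicz Φ p) : Set ℝ :=
  {r | 0 < r ∧ p.lexpect (fun x => Φ (r⁻¹ * f.1 x)) ≤ 1}

/-- The Luxemburg norm. -/
noncomputable instance : Norm (orlicz Φ p) := ⟨fun f => sInf (luxRadii f)⟩

theorem norm_def (f : orlicz Φ p) : ‖f‖ = sInf (luxRadii f) := rfl

theorem luxRadii_nonempty (f : orlicz Φ p) : (luxRadii f).Nonempty := by
  obtain ⟨α, hα, hf⟩ := f.2
  set M := p.lexpect (fun x => Φ (α * f.1 x)) with hM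
  have hpos : 0 < M.toReal + 1 := by positivity
  refine ⟨((M.toReal + 1)⁻¹ * α)⁻¹, by positivity, ?_⟩
  rw [inv_inv]
  simp only [mul_assoc]
  refine (modular_smul_le Φ p f.1 (inv_nonneg.2 hpos.le)
    (inv_le_one_of_one_le₀ (by linarith [M.toReal_nonneg])) α).trans ?_
  rw [← hM, ← ENNReal.ofReal_toReal hf.ne, ← ENNReal.ofReal_mul (by positivity),
    ENNReal.ofReal_toReal hf.ne, ← ENNReal.ofReal_one]
  refine ENNReal.ofReal_le_ofReal ?_
  rw [inv_mul_le_iff₀ hpos]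
  linarith

theorem luxRadii_bddBelow (f : orlicz Φ p) : BddBelow (luxRadii f) :=
  ⟨0, fun _ hr => hr.1.le⟩

theorem lux_nonneg (f : orlicz Φ p) : 0 ≤ ‖f‖ :=
  Real.sInf_nonneg fun _ hr => hr.1.le

theorem luxRadii_add {f g : orlicz Φ p} {r s : ℝ} (hr : r ∈ luxRadii f)
    (hs : s ∈ luxRadii g) : r + s ∈ luxRadii (f + g) := by
  obtain ⟨hr0, hr⟩ := hr
  obtain ⟨hs0, hs⟩ := hs
  have h0 : 0 < r + s := add_pos hr0 hs0
  refine ⟨h0, (le_of_eq_of_le (p.lexpect_congr ?_) (modular_comb_le Φ p f.1 g.1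
    (a := r / (r + s)) (b := s / (r + s)) (by positivity) (by positivity)
    (by field_simp) r⁻¹ s⁻¹)).trans ?_⟩
  · filter_upwards [AEEqFun.coeFn_add f.1 g.1] with x hx
    rw [Submodule.coe_add, hx, Pi.add_apply]
    congr 1
    field_simp
  · calc _ ≤ ENNReal.ofReal (r / (r + s)) * 1 + ENNReal.ofReal (s / (r + s)) * 1 := by gcongr
      _ = 1 := by
        rw [mul_one, mul_one, ← ENNReal.ofReal_add (by positivity) (by positivity),
          ← add_div, div_self h0.ne', ENNReal.ofReal_one]

theorem luxRadii_smul {f : orlicz Φ p} {r : ℝ} (hr : r ∈ luxRadii f) {c : ℝ} (hc : c ≠ 0) :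
    |c| * r ∈ luxRadii (c • f) := by
  obtain ⟨hr0, hr⟩ := hr
  refine ⟨by positivity, le_of_eq_of_le (p.lexpect_congr ?_) hr⟩
  filter_upwards [AEEqFun.coeFn_smul c f.1] with x hx
  rw [Submodule.coe_smul, hx, Pi.smul_apply, smul_eq_mul, ← Φ.map_abs,
    ← Φ.map_abs (_ * (f.1 : Ω →ₘ[μ] ℝ) x)]
  congr 1
  simp only [abs_mul, abs_inv, abs_abs]
  field_simp

theorem lux_add_le (f g : orlicz Φ p) : ‖f + g‖ ≤ ‖f‖ + ‖g‖ := by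
  refine le_of_forall_pos_le_add fun ε hε => ?_
  obtain ⟨r, hr, hr'⟩ := Real.lt_sInf_add_pos (luxRadii_nonempty f) (half_pos hε)
  obtain ⟨s, hs, hs'⟩ := Real.lt_sInf_add_pos (luxRadii_nonempty g) (half_pos hε)
  have := csInf_le (luxRadii_bddBelow (f + g)) (luxRadii_add hr hs)
  simp only [norm_def]
  linarith

theorem lux_zero : ‖(0 : orlicz Φ p)‖ = 0 := by
  refine le_antisymm (le_of_forall_pos_le_add fun ε hε => ?_) (lux_nonneg _)
  rw [zero_add]
  refine csInf_le (luxRadii_bddBelow _) ⟨hε, ?_⟩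
  rw [p.lexpect_congr (g := fun _ => 0)]
  · simp [PosDensity.lexpect]
  · filter_upwards [AEEqFun.coeFn_zero (α := Ω) (β := ℝ) (μ := μ)] with x hx
    rw [Submodule.coe_zero, hx]
    simp [Φ.map_zero]

theorem lux_smul_le {c : ℝ} (hc : c ≠ 0) (f : orlicz Φ p) : ‖c • f‖ ≤ |c| * ‖f‖ := by
  have hc' : 0 < |c| := abs_pos.2 hc
  rw [← div_le_iff₀' hc']
  refine le_csInf (luxRadii_nonempty f) fun r hr => ?_
  rw [div_le_iff₀' hc']
  exact csInf_le (luxRadii_bddBelow _) (luxRadii_smul hr hc)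

theorem lux_smul (c : ℝ) (f : orlicz Φ p) : ‖c • f‖ = ‖c‖ * ‖f‖ := by
  by_cases hc : c = 0
  · rw [hc, zero_smul, lux_zero, norm_zero, zero_mul]
  · refine le_antisymm (lux_smul_le hc f) ?_
    have h := lux_smul_le (inv_ne_zero hc) (c • f)
    rw [smul_smul, inv_mul_cancel₀ hc, one_smul, abs_inv,
      inv_mul_eq_div, le_div_iff₀' (abs_pos.2 hc)] at h
    exact h

theorem eq_zero_of_lux {f : orlicz Φ p} (h : ‖f‖ = 0) : f = 0 := by
  have hle : ∀ ε : ℝ, 0 < ε → ε ≤ 1 → p.lexpect (fun x => Φ (f.1 x)) ≤ ENNReal.ofReal ε := by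
    intro ε hε hε1
    obtain ⟨r, ⟨hr0, hr⟩, hr'⟩ := Real.lt_sInf_add_pos (luxRadii_nonempty f) hε
    rw [← norm_def, h, zero_add] at hr'
    have h2 := modular_smul_le Φ p f.1 hr0.le (hr'.le.trans hε1) r⁻¹
    simp only [mul_inv_cancel_left₀ hr0.ne'] at h2
    refine h2.trans ((mul_le_mul_right hr _).trans ?_)
    rw [mul_one]
    exact ENNReal.ofReal_le_ofReal hr'.le
  have h0 : p.lexpect (fun x => Φ (f.1 x)) = 0 := by
    refine le_antisymm (le_of_forall_gt_imp_ge_of_dense fun c hc => ?_) zero_le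
    by_cases hct : c = ∞
    · rw [hct]; exact le_top
    · have hcr : 0 < c.toReal := ENNReal.toReal_pos hc.ne' hct
      refine (hle (min c.toReal 1) (lt_min hcr one_pos) (min_le_right _ _)).trans ?_
      refine (ENNReal.ofReal_le_ofReal (min_le_left _ _)).trans ?_
      rw [ENNReal.ofReal_toReal hct]
  have hm : AEMeasurable (fun x => ENNReal.ofReal (Φ (f.1 x)) * ENNReal.ofReal (p x)) μ :=
    (Φ.continuous.measurable.comp_aemeasurable f.1.aemeasurable).ennreal_ofReal.mul
      p.aemeasurable.ennreal_ofReal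
  have h1 := (lintegral_eq_zero_iff' hm).1 h0
  apply Subtype.ext
  apply AEEqFun.ext
  filter_upwards [h1, p.pos, AEEqFun.coeFn_zero (α := Ω) (β := ℝ) (μ := μ)] with x hx hp hz
  rw [Submodule.coe_zero, hz]
  by_contra hne
  have h3 := ENNReal.mul_pos (ENNReal.ofReal_pos.2 (Φ.pos _ hne)).ne'
    (ENNReal.ofReal_pos.2 hp).ne'
  exact h3.ne' hx

theorem lux_core : NormedSpace.Core ℝ (orlicz Φ p) where
  norm_nonneg := lux_nonneg
  norm_smul := lux_smul
  norm_triangle := lux_add_le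
  norm_eq_zero_iff f := ⟨eq_zero_of_lux, fun h => by rw [h, lux_zero]⟩

noncomputable instance : NormedAddCommGroup (orlicz Φ p) := NormedAddCommGroup.ofCore lux_core

noncomputable instance : NormedSpace ℝ (orlicz Φ p) := NormedSpace.ofCore lux_core

theorem integrable_mul_density {f : Ω →ₘ[μ] ℝ} (hf : f ∈ orlicz Φ p) :
    Integrable (fun x => f x * p x) μ := by
  obtain ⟨α, hα, hf⟩ := hf
  have hc := Φ.pos 1 one_ne_zero
  have hΦ : Integrable (fun x => Φ (α * f x) * p x) μ := by
    refine ⟨((Φ.continuous.measurable.comp_aemeasurable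
      (f.aemeasurable.const_mul α)).mul p.aemeasurable).aestronglyMeasurable, ?_⟩
    rw [hasFiniteIntegral_iff_ofReal
      (p.pos.mono fun x hx => mul_nonneg (Φ.nonneg _) hx.le)]
    refine lt_of_eq_of_lt (lintegral_congr fun x => ?_) hf
    rw [ENNReal.ofReal_mul (Φ.nonneg _)]
  refine (((p.integrable.const_mul (Φ 1)).add hΦ).const_mul (Φ 1 * α)⁻¹).mono'
    (f.aemeasurable.mul p.aemeasurable).aestronglyMeasurable ?_
  filter_upwards [p.pos] with x hx
  have h := Φ.mul_abs_le (α * f x)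
  rw [Real.norm_eq_abs, abs_mul, abs_of_pos hx, inv_mul_eq_div, le_div_iff₀ (by positivity)]
  rw [abs_mul, abs_of_pos hα] at h
  simp only [Pi.add_apply]
  nlinarith [mul_le_mul_of_nonneg_right h hx.le]

variable (Φ p)

theorem const_mem_orlicz (c : ℝ) : AEEqFun.const Ω c ∈ orlicz Φ p := by
  refine ⟨1, one_pos, ?_⟩
  rw [p.lexpect_congr (g := fun _ => Φ c)]
  · unfold PosDensity.lexpect
    rw [lintegral_const_mul' _ _ ENNReal.ofReal_ne_top, p.lintegral_eq_one, mul_one]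
    exact ENNReal.ofReal_lt_top
  · filter_upwards [AEEqFun.coeFn_const (α := Ω) (μ := μ) c] with x hx
    simp [hx]

/-- `L^Φ_0(p)`: the centred elements of `L^Φ(p)`. -/
noncomputable def centered : Submodule ℝ (orlicz Φ p) where
  carrier := {f | p.expect f.1 = 0}
  zero_mem' := by
    show p.expect _ = 0
    rw [p.expect_congr (g := fun _ => 0)]
    · simp [PosDensity.expect]
    · filter_upwards [AEEqFun.coeFn_zero (α := Ω) (β := ℝ) (μ := μ)] with x hx
      rw [Submodule.coe_zero, hx, Pi.zero_apply]
  add_mem' := by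
    intro f g hf hg
    show p.expect _ = 0
    rw [p.expect_congr (f := (f + g).1) (g := fun x => f.1 x + g.1 x)
      (AEEqFun.coeFn_add f.1 g.1)]
    simp only [PosDensity.expect, add_mul]
    rw [integral_add (integrable_mul_density f.2) (integrable_mul_density g.2)]
    exact (congrArg₂ (· + ·) hf hg).trans (add_zero 0)
  smul_mem' := by
    intro c f hf
    show p.expect _ = 0
    rw [p.expect_congr (f := (c • f).1) (g := fun x => c * f.1 x)
      (AEEqFun.coeFn_smul c f.1)]
    simp only [PosDensity.expect, mul_assoc]
    rw [integral_const_mul]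
    exact (congrArg (c * ·) hf).trans (mul_zero c)

end Orlicz

/-! ### The model spaces, the exponential charts and the transports -/

/-- `B_p = L^Φ_0(p)` with `Φ = cosh - 1`: the fibre at `p` of the tangent bundle. -/
abbrev B (p : PosDensity μ) : Type _ := centered coshYoung p

/-- `*B_p = L^{Φ_*}_0(p)`: the fibre at `p` of the pretangent bundle. -/
abbrev preB (p : PosDensity μ) : Type _ := centered coshYoungConj p

theorem center_mem {p : PosDensity μ} {f : Ω →ₘ[μ] ℝ} (hf : f ∈ orlicz coshYoung p) :
    (⟨f, hf⟩ - ⟨_, const_mem_orlicz coshYoung p (p.expect f)⟩ : orlicz coshYoung p)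
      ∈ centered coshYoung p := by
  show p.expect _ = 0
  rw [p.expect_congr (g := fun x => f x - p.expect f)]
  · simp only [PosDensity.expect, sub_mul]
    rw [integral_sub (integrable_mul_density hf) (p.integrable.const_mul _),
      integral_const_mul]
    have := p.expect_one
    simp only [PosDensity.expect, one_mul] at this
    rw [this, mul_one, sub_self]
  · filter_upwards [AEEqFun.coeFn_sub f (AEEqFun.const Ω (p.expect f)),
      AEEqFun.coeFn_const (α := Ω) (μ := μ) (p.expect f)] with x hx hc
    rw [Submodule.coe_sub, hx, Pi.sub_apply, hc, Function.const]

open Classical in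
/-- `f - E_p[f]` as an element of `B_p`, for `f ∈ L^Φ(p)` (and `0` for any other `f`). -/
noncomputable def center (p : PosDensity μ) (f : Ω →ₘ[μ] ℝ) : B p :=
  if hf : f ∈ orlicz coshYoung p then ⟨_, center_mem hf⟩ else 0

/-- The cumulant generating functional `K_p(u) = log E_p[e^u] ∈ (-∞, +∞]` on `B_p`. -/
noncomputable def cumulant (p : PosDensity μ) (u : B p) : EReal :=
  ENNReal.log (p.lexpect fun x => Real.exp (u.1.1 x))

/-- `S_p`: the interior in `B_p` of the proper domain of `K_p`. -/
def chartDomain (p : PosDensity μ) : Set (B p) :=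
  interior {u | cumulant p u < ⊤}

/-- The class of `e^{u - K_p(u)} p`. -/
noncomputable def gibbs (p : PosDensity μ) (u : B p) : Ω →ₘ[μ] ℝ :=
  AEEqFun.mk (fun x => Real.exp (u.1.1 x - (cumulant p u).toReal) * p x)
    ((Real.measurable_exp.comp_aemeasurable
      (u.1.1.aemeasurable.sub_const _)).mul p.aemeasurable).aestronglyMeasurable

theorem gibbs_pos (p : PosDensity μ) (u : B p) : ∀ᵐ x ∂μ, 0 < gibbs p u x := by
  filter_upwards [p.pos, AEEqFun.coeFn_mk (μ := μ)
    (fun x => Real.exp (u.1.1 x - (cumulant p u).toReal) * p x)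
    ((Real.measurable_exp.comp_aemeasurable
      (u.1.1.aemeasurable.sub_const _)).mul p.aemeasurable).aestronglyMeasurable] with x hp hx
  rw [gibbs, hx]
  exact mul_pos (Real.exp_pos _) hp

theorem lintegral_gibbs {p : PosDensity μ} {u : B p} (hu : cumulant p u < ⊤) :
    ∫⁻ x, ENNReal.ofReal (gibbs p u x) ∂μ = 1 := by
  set M := p.lexpect fun x => Real.exp (u.1.1 x) with hM
  have hcum : cumulant p u = ENNReal.log M := rfl
  have hMtop : M ≠ ∞ := by
    rw [hcum, ENNReal.log_lt_top_iff] at hu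
    exact hu.ne
  have hM0 : M ≠ 0 := by
    intro h0
    have hm : AEMeasurable
        (fun x => ENNReal.ofReal (Real.exp (u.1.1 x)) * ENNReal.ofReal (p x)) μ :=
      (Real.measurable_exp.comp_aemeasurable u.1.1.aemeasurable).ennreal_ofReal.mul
        p.aemeasurable.ennreal_ofReal
    have h1 := (lintegral_eq_zero_iff' hm).1 h0
    have h2 : ∫⁻ x, ENNReal.ofReal (p x) ∂μ = 0 := by
      rw [lintegral_eq_zero_iff' p.aemeasurable.ennreal_ofReal]
      filter_upwards [h1] with x hx
      have := mul_eq_zero.1 hx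
      exact this.resolve_left (ENNReal.ofReal_pos.2 (Real.exp_pos _)).ne'
    rw [p.lintegral_eq_one] at h2
    exact one_ne_zero h2
  have hMr : 0 < M.toReal := ENNReal.toReal_pos hM0 hMtop
  have hK : (cumulant p u).toReal = Real.log M.toReal := by
    rw [hcum, ENNReal.log_pos_real hM0 hMtop, EReal.toReal_coe]
  have h : ∀ᵐ x ∂μ, ENNReal.ofReal (gibbs p u x) = ENNReal.ofReal M.toReal⁻¹ *
      (ENNReal.ofReal (Real.exp (u.1.1 x)) * ENNReal.ofReal (p x)) := by
    filter_upwards [AEEqFun.coeFn_mk (μ := μ)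
      (fun x => Real.exp (u.1.1 x - (cumulant p u).toReal) * p x)
      ((Real.measurable_exp.comp_aemeasurable
        (u.1.1.aemeasurable.sub_const _)).mul p.aemeasurable).aestronglyMeasurable] with x hx
    rw [gibbs, hx, hK, Real.exp_sub, Real.exp_log hMr, ← ENNReal.ofReal_mul (Real.exp_pos _).le,
      ← ENNReal.ofReal_mul (inv_nonneg.2 hMr.le)]
    congr 1
    ring
  rw [lintegral_congr_ae h, lintegral_const_mul' _ _ ENNReal.ofReal_ne_top]
  change ENNReal.ofReal M.toReal⁻¹ * M = 1
  rw [ENNReal.ofReal_inv_of_pos hMr, ENNReal.ofReal_toReal hMtop,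
    ENNReal.inv_mul_cancel hM0 hMtop]

open Classical in
/-- `e_p(u) = e^{u - K_p(u)} p` for `u` in the proper domain of `K_p`, in particular on `S_p`
(and `p` for any other `u`). -/
noncomputable def e (p : PosDensity μ) (u : B p) : PosDensity μ :=
  if hu : cumulant p u < ⊤ then ⟨gibbs p u, gibbs_pos p u, lintegral_gibbs hu⟩ else p

/-- The maximal exponential model `ℰ(p) = {e^{u - K_p(u)} p | u ∈ S_p}`. -/
def maxExp (p : PosDensity μ) : Set (PosDensity μ) := e p '' chartDomain p

/-- The chart `s_p(q) = log(q/p) - E_p[log(q/p)]` (used for `q ∈ ℰ(p)` only). -/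
noncomputable def s (p q : PosDensity μ) : B p :=
  center p (AEEqFun.mk (fun x => Real.log (q x / p x))
    (Real.measurable_log.comp_aemeasurable
      (q.aemeasurable.div p.aemeasurable)).aestronglyMeasurable)

/-- The exponential transport `B_p → B_q`, `v ↦ v - E_q[v]`. When `q ∈ ℰ(p)` one has
`L^Φ(p) = L^Φ(q)`, so that `v ∈ L^Φ(q)`. -/
noncomputable def eTransport (p q : PosDensity μ) (v : B p) : B q := center q v.1.1

/-- The class of `(p/q) v`. -/
noncomputable def ratioMul (p q : PosDensity μ) (v : Ω →ₘ[μ] ℝ) : Ω →ₘ[μ] ℝ :=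
  AEEqFun.mk (fun x => p x / q x * v x)
    ((p.aemeasurable.div q.aemeasurable).mul v.aemeasurable).aestronglyMeasurable

theorem ratioMul_centered {p q : PosDensity μ} (v : preB p)
    (h : ratioMul p q v.1.1 ∈ orlicz coshYoungConj q) :
    (⟨_, h⟩ : orlicz coshYoungConj q) ∈ centered coshYoungConj q := by
  have hv : p.expect v.1.1 = 0 := v.2
  show q.expect (ratioMul p q v.1.1) = 0
  rw [← hv]
  refine integral_congr_ae ?_
  filter_upwards [q.pos, AEEqFun.coeFn_mk (μ := μ) (fun x => p x / q x * v.1.1 x)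
    ((p.aemeasurable.div q.aemeasurable).mul v.1.1.aemeasurable).aestronglyMeasurable]
    with x hq hx
  rw [ratioMul, hx]
  field_simp

open Classical in
/-- The mixture transport `*B_p → *B_q`, `v ↦ (p/q) v`. When `q ∈ ℰ(p)` one has
`(p/q) v ∈ L^{Φ_*}(q)` for all `v ∈ *B_p` (the value is `0` where this fails). -/
noncomputable def mTransport (p q : PosDensity μ) (v : preB p) : preB q :=
  if h : ratioMul p q v.1.1 ∈ orlicz coshYoungConj q then ⟨⟨_, h⟩, ratioMul_centered v h⟩ else 0

/-! ### Fields on a maximal exponential model, `C¹` regularity and covariant derivatives -/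

/-- The representation `F_p(u)` in the chart at `p` of a vector field of the tangent bundle. -/
noncomputable def eRep (p : PosDensity μ) (F : ∀ q : PosDensity μ, B q) (u : B p) : B p :=
  eTransport (e p u) p (F (e p u))

/-- The representation `F_p(u)` in the chart at `p` of a vector field of the pretangent bundle. -/
noncomputable def mRep (p : PosDensity μ) (F : ∀ q : PosDensity μ, preB q) (u : B p) : preB p :=
  mTransport (e p u) p (F (e p u))

/-- A real function is `C¹` on `ℰ` if its representation in every chart is. -/
def IsC1Fun (ℰ : Set (PosDensity μ)) (E : PosDensity μ → ℝ) : Prop :=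
  ∀ p ∈ ℰ, ContDiffOn ℝ 1 (fun u => E (e p u)) (chartDomain p)

/-- A tangent vector field is `C¹` on `ℰ` if its representation in every chart is. -/
def IsC1Tangent (ℰ : Set (PosDensity μ)) (F : ∀ q : PosDensity μ, B q) : Prop :=
  ∀ p ∈ ℰ, ContDiffOn ℝ 1 (eRep p F) (chartDomain p)

/-- A pretangent vector field is `C¹` on `ℰ` if its representation in every chart is. -/
def IsC1Pretangent (ℰ : Set (PosDensity μ)) (F : ∀ q : PosDensity μ, preB q) : Prop :=
  ∀ p ∈ ℰ, ContDiffOn ℝ 1 (mRep p F) (chartDomain p)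

/-- Covariant derivative of a real function, in the chart at `p`:
`D_H E(q) = dE_p(s_p(q)) (transport of H(q) from q to p)`. -/
noncomputable def covDerivFun (p : PosDensity μ) (H : ∀ q : PosDensity μ, B q)
    (E : PosDensity μ → ℝ) (q : PosDensity μ) : ℝ :=
  fderiv ℝ (fun u => E (e p u)) (s p q) (eTransport q p (H q))

/-- Covariant derivative of a tangent vector field, in the chart at `p`. -/
noncomputable def covDerivTangent (p : PosDensity μ) (H G : ∀ q : PosDensity μ, B q)
    (q : PosDensity μ) : B q :=
  eTransport p q (fderiv ℝ (eRep p G) (s p q) (eTransport q p (H q)))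

/-- Covariant derivative of a pretangent vector field: `D_H F(q) = dF_q(0) H(q)`. -/
noncomputable def covDerivPretangent (H : ∀ q : PosDensity μ, B q)
    (F : ∀ q : PosDensity μ, preB q) (q : PosDensity μ) : preB q :=
  fderiv ℝ (mRep q F) 0 (H q)

/-- The duality coupling `⟨v, w⟩_q = E_q[v w]` of the fibres at `q`. -/
noncomputable def coupling (q : PosDensity μ) (v : preB q) (w : B q) : ℝ :=
  q.expect fun x => v.1.1 x * w.1.1 x

end ExpManifold

open MeasureTheory Set
open scoped ENNReal

namespace ExpManifold

variable {Ω : Type*} [MeasurableSpace Ω] {μ : Measure Ω}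

/-! ### The conjugate pair -/

/-! Read in a chart, the formula is the Leibniz rule for a bounded bilinear map. The two transports
are dual: for `v` centred at `q`, `E_p[(q/p) v (w - E_p[w])] = E_q[v w] - E_p[w] E_q[v] = E_q[v w]`
(`coupling_transport`). So in the chart at `p` the function `⟨F, G⟩` is the coupling at the fixed
density `p` of the representations of `F` and `G`. By Hölder's inequality this coupling is
continuous (`couplingL`), which gives the `C¹` claim, and in the chart at `q`, at the point `0`, the
product rule.

Independence of the charts holds because chart changes are affine with the exponential transport as
linear part (`e_affine`), and these transports compose (`eTransport_eTransport`). By the chain rule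
every covariant derivative reduces to a derivative at `0` in the chart at `q` (`covDerivFun_eq`,
`covDerivTangent_eq`). Continuity of the mixture transport is never needed, since `F` is
differentiated only in its own chart at `q`.

The analytic content is that the transports are genuinely defined inside one model (`Compatible`).
It follows from `E_p[(q/p)^(1+ε)] < ∞` together with the same bound with `p` and `q` exchanged
(`TiltBound`, `Compatible.of_mem_maxExp`). -/

theorem coshYoung_apply (y : ℝ) : coshYoung y = Real.cosh y - 1 := rfl

theorem coshYoungConj_sinh (a : ℝ) :
    coshYoungConj (Real.sinh a) = Real.sinh a * a - Real.cosh a + 1 := by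
  show Real.sinh a * Real.arsinh (Real.sinh a) - √(1 + Real.sinh a ^ 2) + 1 = _
  rw [Real.arsinh_sinh, ← Real.cosh_sq', Real.sqrt_sq (Real.cosh_pos a).le]

/-- After `x = sinh a` this says that the tangent to `cosh` at `a` stays below `cosh`. It is the
half-sum of the tangent inequalities for `exp` at `a` and at `-a`. -/
theorem fenchel_young (x y : ℝ) : x * y ≤ coshYoungConj x + coshYoung y := by
  obtain ⟨a, rfl⟩ := Real.sinh_surjective x
  rw [coshYoungConj_sinh, coshYoung_apply]
  have h1 : Real.exp a * (y - a + 1) ≤ Real.exp y := by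
    have := mul_le_mul_of_nonneg_left (Real.add_one_le_exp (y - a)) (Real.exp_pos a).le
    rwa [← Real.exp_add, add_sub_cancel] at this
  have h2 : Real.exp (-a) * (a - y + 1) ≤ Real.exp (-y) := by
    have := mul_le_mul_of_nonneg_left (Real.add_one_le_exp (a - y)) (Real.exp_pos (-a)).le
    rwa [← Real.exp_add, show -a + (a - y) = -y by ring] at this
  rw [Real.sinh_eq, Real.cosh_eq, Real.cosh_eq]
  nlinarith

theorem fenchel_young_abs (x y : ℝ) : |x * y| ≤ coshYoungConj x + coshYoung y := by
  rw [abs_mul, ← coshYoungConj.map_abs x, ← coshYoung.map_abs y]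
  exact fenchel_young _ _

/-- The derivative `arsinh` of `Φ_*` grows only logarithmically, so a dilation by `e^l` costs,
beyond the factor `e^l`, a term linear in the positive part of `l`. This is what makes
multiplication by a density ratio manageable in `L^{Φ_*}`. -/
theorem coshYoungConj_exp_mul_le (l x : ℝ) :
    coshYoungConj (Real.exp l * x) ≤ Real.exp l * (coshYoungConj x + |x| * max l 0) := by
  wlog hx : 0 ≤ x with H
  · have := H l (-x) (by linarith)
    rwa [mul_neg, coshYoungConj.even, coshYoungConj.even, abs_neg] at this
  rw [abs_of_nonneg hx]
  rcases le_total l 0 with hl | hl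
  · rw [max_eq_right hl, mul_zero, add_zero]
    exact coshYoungConj.map_smul_le (Real.exp_pos l).le (Real.exp_le_one_iff.2 hl) x
  rw [max_eq_left hl]
  obtain ⟨y, hy⟩ := Real.sinh_surjective (Real.exp l * x)
  have hr : 1 ≤ Real.exp l := Real.one_le_exp hl
  -- Equality case of Fenchel–Young at `sinh y = e^l x`.
  have hz : coshYoungConj (Real.exp l * x) = Real.exp l * x * y - coshYoung y := by
    rw [← hy, coshYoungConj_sinh, coshYoung_apply]; ring
  rw [hz]
  rcases le_total y l with h | h
  · nlinarith [coshYoung.nonneg y, coshYoungConj.nonneg x,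
      mul_le_mul_of_nonneg_left h (mul_nonneg (Real.exp_pos l).le hx),
      mul_nonneg (Real.exp_pos l).le (coshYoungConj.nonneg x)]
  · have h1 := mul_le_mul_of_nonneg_left (fenchel_young x (y - l)) (Real.exp_pos l).le
    -- With `r = e^l` and `t = e^y` the difference of the two sides factors, and `t ≥ r ≥ 1` makes
    -- each factor nonnegative.
    have h2 : Real.exp l * coshYoung (y - l) ≤ coshYoung y := by
      rw [coshYoung_apply, coshYoung_apply, Real.cosh_eq, Real.cosh_eq, neg_sub,
        Real.exp_sub, Real.exp_sub, Real.exp_neg]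
      have hy1 : Real.exp l ≤ Real.exp y := Real.exp_le_exp.2 h
      set r := Real.exp l
      set t := Real.exp y
      have hr0 : 0 < r := by linarith
      have ht0 : 0 < t := by linarith
      have h3 : t - (r + 1) / 2 ≥ 0 := by linarith
      have h4 : (t + t⁻¹) / 2 - 1 - r * ((t / r + r / t) / 2 - 1)
          = (r - 1) * (t - (r + 1) / 2) / t := by
        field_simp
        ring
      have h5 : 0 ≤ (r - 1) * (t - (r + 1) / 2) / t :=
        div_nonneg (mul_nonneg (by linarith) h3) ht0.le
      linarith
    nlinarith

/-! ### Expectations under a change of density -/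

namespace PosDensity

variable {p q : PosDensity μ}

theorem ext_of_ae (h : q =ᵐ[μ] p) : q = p := by
  have := AEEqFun.ext h
  cases p; cases q; simp only at this; subst this; rfl

/-- Proportional densities are equal. -/
theorem ext_of_ae_mul {c : ℝ} (h : ∀ᵐ x ∂μ, q x = c * p x) : q = p := by
  have h1 : q.expect (fun _ => 1) = c * p.expect (fun _ => 1) := by
    simp only [expect, one_mul]
    rw [← integral_const_mul]
    exact integral_congr_ae h
  rw [expect_one, expect_one, mul_one] at h1
  refine ext_of_ae ?_
  filter_upwards [h] with x hx
  rw [hx, ← h1, one_mul]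

theorem lexpect_mono_ae {f g : Ω → ℝ} (h : ∀ᵐ x ∂μ, f x ≤ g x) : p.lexpect f ≤ p.lexpect g := by
  refine lintegral_mono_ae ?_
  filter_upwards [h] with x hx
  gcongr

theorem lexpect_const (c : ℝ) : p.lexpect (fun _ => c) = ENNReal.ofReal c := by
  unfold lexpect
  rw [lintegral_const_mul' _ _ ENNReal.ofReal_ne_top, p.lintegral_eq_one, mul_one]

theorem lexpect_tilt {L : Ω → ℝ} (h : ∀ᵐ x ∂μ, q x = Real.exp (L x) * p x) (f : Ω → ℝ) :
    q.lexpect f = p.lexpect fun x => Real.exp (L x) * f x := by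
  refine lintegral_congr_ae ?_
  filter_upwards [h] with x hx
  rw [hx, ENNReal.ofReal_mul (Real.exp_pos _).le, ENNReal.ofReal_mul (Real.exp_pos _).le]
  ring

end PosDensity

/-! ### Hölder's inequality -/

/-- Integrate Fenchel–Young for `v / r` and `w / t`: each modular is at most `1`, whence the
constant `2`. The `lintegral` form yields integrability of the product as well as the norm bound. -/
theorem holder_modular {p : PosDensity μ} (v : orlicz coshYoungConj p) (w : orlicz coshYoung p)
    {r t : ℝ} (hr : r ∈ luxRadii v) (ht : t ∈ luxRadii w) :
    ∫⁻ x, ENNReal.ofReal ‖v.1 x * w.1 x * p x‖ ∂μ ≤ ENNReal.ofReal (2 * r * t) := by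
  obtain ⟨hr0, hr⟩ := hr
  obtain ⟨ht0, ht⟩ := ht
  have hm : AEMeasurable (fun x => coshYoungConj (r⁻¹ * v.1 x)) μ :=
    coshYoungConj.continuous.measurable.comp_aemeasurable (v.1.aemeasurable.const_mul _)
  calc ∫⁻ x, ENNReal.ofReal ‖v.1 x * w.1 x * p x‖ ∂μ
      ≤ p.lexpect (fun x => (r * t) * coshYoungConj (r⁻¹ * v.1 x)
          + (r * t) * coshYoung (t⁻¹ * w.1 x)) := by
        refine lintegral_mono_ae ?_
        filter_upwards [p.pos] with x hx
        rw [norm_mul, Real.norm_of_nonneg hx.le, ENNReal.ofReal_mul (norm_nonneg _)]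
        gcongr
        have h := fenchel_young_abs (r⁻¹ * v.1 x) (t⁻¹ * w.1 x)
        rw [Real.norm_eq_abs, ← mul_add]
        calc |v.1 x * w.1 x| = (r * t) * |r⁻¹ * v.1 x * (t⁻¹ * w.1 x)| := by
              rw [abs_mul, abs_mul, abs_mul, abs_mul, abs_inv, abs_inv, abs_of_pos hr0,
                abs_of_pos ht0]
              field_simp
          _ ≤ _ := by gcongr
    _ = ENNReal.ofReal (r * t) * p.lexpect (fun x => coshYoungConj (r⁻¹ * v.1 x))
        + ENNReal.ofReal (r * t) * p.lexpect (fun x => coshYoung (t⁻¹ * w.1 x)) :=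
        p.lexpect_comb hm (fun _ => YoungFunction.nonneg _ _) (fun _ => YoungFunction.nonneg _ _)
          (by positivity) (by positivity)
    _ ≤ ENNReal.ofReal (r * t) * 1 + ENNReal.ofReal (r * t) * 1 := by gcongr
    _ = ENNReal.ofReal (2 * r * t) := by
        rw [mul_one, ← ENNReal.ofReal_add (by positivity) (by positivity)]
        congr 1; ring

theorem integrable_mul_mul_density {p : PosDensity μ} (v : orlicz coshYoungConj p)
    (w : orlicz coshYoung p) : Integrable (fun x => v.1 x * w.1 x * p x) μ := by
  refine ⟨((v.1.aemeasurable.mul w.1.aemeasurable).mul p.aemeasurable).aestronglyMeasurable, ?_⟩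
  rw [hasFiniteIntegral_iff_norm]
  obtain ⟨r, hr⟩ := luxRadii_nonempty v
  obtain ⟨t, ht⟩ := luxRadii_nonempty w
  exact (holder_modular v w hr ht).trans_lt ENNReal.ofReal_lt_top

theorem le_mul_norm_of_radii {Φ : YoungFunction} {p : PosDensity μ} (f : orlicz Φ p) {a c : ℝ}
    (hc : 0 ≤ c) (h : ∀ r ∈ luxRadii f, a ≤ c * r) : a ≤ c * ‖f‖ := by
  refine le_of_forall_pos_le_add fun δ hδ => ?_
  -- Dividing by `c + 1` instead of `c` covers `c = 0`.
  obtain ⟨r, hr, hr'⟩ := Real.lt_sInf_add_pos (luxRadii_nonempty f)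
    (show 0 < δ / (c + 1) by positivity)
  rw [← norm_def] at hr'
  calc a ≤ c * r := h r hr
    _ ≤ c * (‖f‖ + δ / (c + 1)) := by gcongr
    _ = c * ‖f‖ + c / (c + 1) * δ := by ring
    _ ≤ c * ‖f‖ + 1 * δ := by
        gcongr
        exact (div_le_one (by positivity)).2 (by linarith)
    _ = _ := by rw [one_mul]

theorem holder {p : PosDensity μ} (v : orlicz coshYoungConj p) (w : orlicz coshYoung p) :
    |p.expect fun x => v.1 x * w.1 x| ≤ 2 * ‖v‖ * ‖w‖ := by
  refine le_mul_norm_of_radii w (mul_nonneg two_pos.le (lux_nonneg v)) fun t ht => ?_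
  rw [mul_right_comm]
  refine le_mul_norm_of_radii v (mul_nonneg two_pos.le ht.1.le) fun r hr => ?_
  have h := holder_modular v w hr ht
  rw [← ofReal_integral_eq_lintegral_ofReal (integrable_mul_mul_density v w).norm
    (Filter.Eventually.of_forall fun _ => norm_nonneg _)] at h
  have hr0 := hr.1
  have ht0 := ht.1
  rw [ENNReal.ofReal_le_ofReal_iff (by positivity)] at h
  calc |p.expect fun x => v.1 x * w.1 x| ≤ ∫ x, ‖v.1 x * w.1 x * p x‖ ∂μ :=
        norm_integral_le_integral_norm fun x => v.1 x * w.1 x * p x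
    _ ≤ 2 * r * t := h
    _ = 2 * t * r := by ring

/-- The duality coupling as a continuous bilinear map. -/
noncomputable def couplingL (p : PosDensity μ) : preB p →L[ℝ] B p →L[ℝ] ℝ :=
  LinearMap.mkContinuous₂
    (LinearMap.mk₂ ℝ (coupling p)
      (by
        intro v v' w
        simp only [coupling, PosDensity.expect]
        rw [← integral_add (integrable_mul_mul_density v.1 w.1)
          (integrable_mul_mul_density v'.1 w.1)]
        refine integral_congr_ae ?_
        filter_upwards [AEEqFun.coeFn_add v.1.1 v'.1.1] with x hx
        rw [Submodule.coe_add, Submodule.coe_add, hx, Pi.add_apply]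
        ring)
      (by
        intro c v w
        simp only [coupling, PosDensity.expect, smul_eq_mul]
        rw [← integral_const_mul]
        refine integral_congr_ae ?_
        filter_upwards [AEEqFun.coeFn_smul c v.1.1] with x hx
        rw [Submodule.coe_smul, Submodule.coe_smul, hx, Pi.smul_apply, smul_eq_mul]
        ring)
      (by
        intro v w w'
        simp only [coupling, PosDensity.expect]
        rw [← integral_add (integrable_mul_mul_density v.1 w.1)
          (integrable_mul_mul_density v.1 w'.1)]
        refine integral_congr_ae ?_
        filter_upwards [AEEqFun.coeFn_add w.1.1 w'.1.1] with x hx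
        rw [Submodule.coe_add, Submodule.coe_add, hx, Pi.add_apply]
        ring)
      (by
        intro c v w
        simp only [coupling, PosDensity.expect, smul_eq_mul]
        rw [← integral_const_mul]
        refine integral_congr_ae ?_
        filter_upwards [AEEqFun.coeFn_smul c w.1.1] with x hx
        rw [Submodule.coe_smul, Submodule.coe_smul, hx, Pi.smul_apply, smul_eq_mul]
        ring))
    2 (fun v w => holder v.1 w.1)

/-! ### Comparison of Orlicz spaces -/

/-- `q = e^L p` with `E_p[(q/p)^(1+ε)] < ∞` for some `ε > 0`. -/
def TiltBound (p q : PosDensity μ) : Prop :=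
  ∃ L : Ω → ℝ, AEMeasurable L μ ∧ (∀ᵐ x ∂μ, q x = Real.exp (L x) * p x) ∧
    ∃ ε : ℝ, 0 < ε ∧ p.lexpect (fun x => Real.exp ((1 + ε) * L x)) < ∞

/-- `L^Φ(p)` is continuously embedded in `L^Φ(q)`. -/
def Embeds (p q : PosDensity μ) : Prop :=
  ∃ C : ℝ, 0 ≤ C ∧ ∀ f : orlicz coshYoung p, ∃ h : f.1 ∈ orlicz coshYoung q,
    ‖(⟨f.1, h⟩ : orlicz coshYoung q)‖ ≤ C * ‖f‖

/-- Convexity of `exp` with the conjugate weights `1/(1+ε)` and `ε/(1+ε)`, at the points `(1+ε) l`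
and `±y`. Shrinking the argument of `cosh` pays for the change of density. -/
theorem exp_mul_cosh_le {ε : ℝ} (hε : 0 < ε) (l y : ℝ) :
    Real.exp l * Real.cosh (ε / (1 + ε) * y) ≤ Real.exp ((1 + ε) * l) + Real.cosh y := by
  have hs : (1 + ε)⁻¹ + ε / (1 + ε) = 1 := by field_simp
  have key : ∀ z : ℝ, Real.exp (l + ε / (1 + ε) * z)
      ≤ (1 + ε)⁻¹ * Real.exp ((1 + ε) * l) + ε / (1 + ε) * Real.exp z := by
    intro z
    have h := convexOn_exp.2 (mem_univ ((1 + ε) * l)) (mem_univ z)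
      (show 0 ≤ (1 + ε)⁻¹ by positivity) (show 0 ≤ ε / (1 + ε) by positivity) hs
    simp only [smul_eq_mul] at h
    rwa [inv_mul_cancel_left₀ (by positivity)] at h
  have h1 := key y
  have h2 := key (-y)
  have h3 : Real.exp l * Real.cosh (ε / (1 + ε) * y)
      = (Real.exp (l + ε / (1 + ε) * y) + Real.exp (l + ε / (1 + ε) * -y)) / 2 := by
    rw [Real.cosh_eq, Real.exp_add, Real.exp_add, mul_neg]; ring
  have h4 : (1 + ε)⁻¹ ≤ 1 := inv_le_one_of_one_le₀ (by linarith)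
  have h5 : ε / (1 + ε) ≤ 1 := (div_le_one (by positivity)).2 (by linarith)
  have h6 : (1 + ε)⁻¹ * Real.exp ((1 + ε) * l) ≤ 1 * Real.exp ((1 + ε) * l) := by gcongr
  have h7 : ε / (1 + ε) * Real.cosh y ≤ 1 * Real.cosh y := by
    gcongr
  rw [h3]
  rw [Real.cosh_eq] at h7 ⊢
  linarith

/-- If `r` is an admissible radius of `f` at `p`, then `E_q[Φ(δ f / r)] ≤ N`, and convexity turns
this into the admissible radius `(N/δ) r` at `q`. -/
theorem TiltBound.embeds {p q : PosDensity μ} (h : TiltBound p q) : Embeds p q := by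
  obtain ⟨L, hLm, hL, ε, hε, hM⟩ := h
  set M := p.lexpect (fun x => Real.exp ((1 + ε) * L x)) with hMdef
  set δ := ε / (1 + ε) with hδ
  have hδ0 : 0 < δ := by positivity
  -- One unit bounds the modular of `f / r`, the other comes from `cosh = Φ + 1`.
  set N := M.toReal + 2 with hN
  have hN1 : 1 ≤ N := by linarith [M.toReal_nonneg]
  have hN0 : 0 < N := by linarith
  have key : ∀ (f : orlicz coshYoung p), ∀ r ∈ luxRadii f,
      0 < N / δ * r ∧ q.lexpect (fun x => coshYoung ((N / δ * r)⁻¹ * f.1 x)) ≤ 1 := by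
    rintro f r ⟨hr0, hr⟩
    refine ⟨by positivity, ?_⟩
    have hmf : AEMeasurable (fun x => coshYoung (r⁻¹ * f.1 x)) μ :=
      coshYoung.continuous.measurable.comp_aemeasurable (f.1.aemeasurable.const_mul _)
    have hmL : AEMeasurable (fun x => Real.exp ((1 + ε) * L x)) μ :=
      Real.measurable_exp.comp_aemeasurable (hLm.const_mul _)
    have h1 : q.lexpect (fun x => coshYoung (δ * (r⁻¹ * f.1 x))) ≤ ENNReal.ofReal N := by
      rw [PosDensity.lexpect_tilt hL]
      calc _ ≤ p.lexpect (fun x => 1 * Real.exp ((1 + ε) * L x)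
              + 1 * (1 * coshYoung (r⁻¹ * f.1 x) + 1 * 1)) := by
            refine p.lexpect_mono fun x => ?_
            have := exp_mul_cosh_le hε (L x) (r⁻¹ * f.1 x)
            rw [coshYoung_apply, coshYoung_apply, mul_sub]
            linarith [Real.exp_pos (L x)]
        _ = M + (p.lexpect (fun x => coshYoung (r⁻¹ * f.1 x)) + 1) := by
            rw [p.lexpect_comb hmL (fun _ => (Real.exp_pos _).le)
              (fun x => by have := coshYoung.nonneg (r⁻¹ * f.1 x); positivity)
              zero_le_one zero_le_one,
              p.lexpect_comb hmf (fun _ => coshYoung.nonneg _) (fun _ => zero_le_one)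
              zero_le_one zero_le_one, PosDensity.lexpect_const]
            simp [hMdef]
        _ ≤ M + (1 + 1) := by gcongr
        _ = ENNReal.ofReal N := by
            rw [hN, ENNReal.ofReal_add ENNReal.toReal_nonneg two_pos.le,
              ENNReal.ofReal_toReal hM.ne]
            norm_num
    have h2 : ∀ x, (N / δ * r)⁻¹ * f.1 x = N⁻¹ * (δ * (r⁻¹ * f.1 x)) := by
      intro x; field_simp
    simp only [h2]
    calc _ ≤ q.lexpect (fun x => N⁻¹ * coshYoung (δ * (r⁻¹ * f.1 x))) :=
          q.lexpect_mono fun x => coshYoung.map_smul_le (by positivity)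
            (inv_le_one_of_one_le₀ hN1) _
      _ = ENNReal.ofReal N⁻¹ * q.lexpect (fun x => coshYoung (δ * (r⁻¹ * f.1 x))) :=
          q.lexpect_smul (by positivity)
      _ ≤ ENNReal.ofReal N⁻¹ * ENNReal.ofReal N := by gcongr
      _ = 1 := by
          rw [← ENNReal.ofReal_mul (by positivity), inv_mul_cancel₀ hN0.ne', ENNReal.ofReal_one]
  refine ⟨N / δ, by positivity, fun f => ?_⟩
  have hmem : f.1 ∈ orlicz coshYoung q := by
    obtain ⟨r, hr⟩ := luxRadii_nonempty f
    obtain ⟨h0, h1⟩ := key f r hr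
    exact ⟨_, inv_pos.2 h0, h1.trans_lt ENNReal.one_lt_top⟩
  refine ⟨hmem, le_mul_norm_of_radii f (by positivity) fun r hr => ?_⟩
  exact csInf_le (luxRadii_bddBelow _) (key f r hr)

theorem coeFn_ratioMul (p q : PosDensity μ) (v : Ω →ₘ[μ] ℝ) :
    ratioMul p q v =ᵐ[μ] fun x => p x / q x * v x :=
  AEEqFun.coeFn_mk _ _

/-- The dilation bound for `Φ_*` leaves `E_q[|α v| L⁺]` to control. Fenchel–Young pairs `|α v|` with
`ε L⁺`, and `E_q[e^{εL}] = E_p[e^{(1+ε)L}]` is finite. The exponent `α` is unchanged. -/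
theorem TiltBound.ratioMul_mem {p q : PosDensity μ} (h : TiltBound p q) {v : Ω →ₘ[μ] ℝ}
    (hv : v ∈ orlicz coshYoungConj q) : ratioMul q p v ∈ orlicz coshYoungConj p := by
  obtain ⟨L, hLm, hL, ε, hε, hM⟩ := h
  obtain ⟨α, hα, hv⟩ := hv
  refine ⟨α, hα, ?_⟩
  have hmv : AEMeasurable (fun x => coshYoungConj (α * v x)) μ :=
    coshYoungConj.continuous.measurable.comp_aemeasurable (v.aemeasurable.const_mul _)
  have hmL : AEMeasurable (fun x => Real.exp (ε * L x)) μ :=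
    Real.measurable_exp.comp_aemeasurable (hLm.const_mul _)
  have hq : q.lexpect (fun x => Real.exp (ε * L x)) < ∞ := by
    rw [PosDensity.lexpect_tilt hL]
    refine lt_of_eq_of_lt ?_ hM
    congr 1
    ext x
    rw [← Real.exp_add]; congr 1; ring
  calc p.lexpect (fun x => coshYoungConj (α * ratioMul q p v x))
      ≤ p.lexpect (fun x => Real.exp (L x) *
          ((1 + ε⁻¹) * coshYoungConj (α * v x) + ε⁻¹ * (1 * Real.exp (ε * L x) + 1 * 1))) := by
        refine PosDensity.lexpect_mono_ae ?_
        filter_upwards [coeFn_ratioMul q p v, hL, p.pos] with x hx hLx hp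
        rw [hx, hLx, mul_div_cancel_right₀ _ hp.ne', mul_left_comm]
        refine (coshYoungConj_exp_mul_le _ _).trans
          (mul_le_mul_of_nonneg_left ?_ (Real.exp_pos _).le)
        have h1 := fenchel_young |α * v x| (ε * max (L x) 0)
        rw [coshYoungConj.map_abs, coshYoung_apply] at h1
        have h2 : Real.cosh (ε * max (L x) 0) - 1 ≤ Real.exp (ε * L x) + 1 := by
          rcases le_total (L x) 0 with hl | hl
          · rw [max_eq_right hl]
            simp only [mul_zero, Real.cosh_zero]
            linarith [Real.exp_pos (ε * L x)]
          · rw [max_eq_left hl, Real.cosh_eq]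
            have : Real.exp (-(ε * L x)) ≤ 1 := Real.exp_le_one_iff.2 (by
              have := mul_nonneg hε.le hl; linarith)
            linarith [Real.exp_pos (ε * L x)]
        have h3 : |α * v x| * max (L x) 0 = ε⁻¹ * (|α * v x| * (ε * max (L x) 0)) := by
          field_simp
        rw [h3, add_mul, one_mul, add_assoc, ← mul_add]
        gcongr
        linarith
    _ = q.lexpect (fun x =>
          (1 + ε⁻¹) * coshYoungConj (α * v x) + ε⁻¹ * (1 * Real.exp (ε * L x) + 1 * 1)) :=
        (PosDensity.lexpect_tilt hL _).symm
    _ < ∞ := by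
        rw [q.lexpect_comb hmv (fun _ => coshYoungConj.nonneg _) (fun x => by positivity)
          (by positivity) (by positivity),
          q.lexpect_comb hmL (fun _ => (Real.exp_pos _).le) (fun _ => zero_le_one)
          zero_le_one zero_le_one, PosDensity.lexpect_const]
        refine ENNReal.add_lt_top.2 ⟨ENNReal.mul_lt_top ENNReal.ofReal_lt_top hv,
          ENNReal.mul_lt_top ENNReal.ofReal_lt_top (ENNReal.add_lt_top.2
            ⟨ENNReal.mul_lt_top ENNReal.ofReal_lt_top hq,
              ENNReal.mul_lt_top ENNReal.ofReal_lt_top ENNReal.ofReal_lt_top⟩)⟩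
/-! ### Compatible densities -/

theorem Embeds.mem {p q : PosDensity μ} (h : Embeds p q) {f : Ω →ₘ[μ] ℝ}
    (hf : f ∈ orlicz coshYoung p) : f ∈ orlicz coshYoung q := by
  obtain ⟨C, -, h⟩ := h
  exact (h ⟨f, hf⟩).1

theorem Embeds.trans {p q r : PosDensity μ} (h : Embeds p q) (h' : Embeds q r) :
    Embeds p r := by
  obtain ⟨C, hC, h⟩ := h
  obtain ⟨C', hC', h'⟩ := h'
  refine ⟨C' * C, by positivity, fun f => ?_⟩
  obtain ⟨h1, h2⟩ := h f
  obtain ⟨h3, h4⟩ := h' ⟨f.1, h1⟩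
  refine ⟨h3, h4.trans ?_⟩
  rw [mul_assoc]
  gcongr

theorem ratioMul_trans (p q r : PosDensity μ) (v : Ω →ₘ[μ] ℝ) :
    ratioMul q p (ratioMul r q v) = ratioMul r p v := by
  refine AEEqFun.ext ?_
  filter_upwards [coeFn_ratioMul q p (ratioMul r q v), coeFn_ratioMul r q v,
    coeFn_ratioMul r p v, q.pos] with x h1 h2 h3 hq
  rw [h1, h2, h3]
  field_simp

/-- Densities with the same Orlicz spaces, and such that the mixture transports are defined. -/
structure Compatible (p q : PosDensity μ) : Prop where
  embeds : Embeds p q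
  embeds_symm : Embeds q p
  ratio : ∀ v ∈ orlicz coshYoungConj p, ratioMul p q v ∈ orlicz coshYoungConj q
  ratio_symm : ∀ v ∈ orlicz coshYoungConj q, ratioMul q p v ∈ orlicz coshYoungConj p
  log_mem : ∃ L ∈ orlicz coshYoung p, ∀ᵐ x ∂μ, q x = Real.exp (L x) * p x

theorem Compatible.symm {p q : PosDensity μ} (h : Compatible p q) : Compatible q p := by
  refine ⟨h.embeds_symm, h.embeds, h.ratio_symm, h.ratio, ?_⟩
  obtain ⟨L, hL, h1⟩ := h.log_mem
  refine ⟨-L, neg_mem (h.embeds.mem hL), ?_⟩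
  filter_upwards [h1, AEEqFun.coeFn_neg L] with x hx hn
  rw [hn, hx, Pi.neg_apply, ← mul_assoc, ← Real.exp_add, neg_add_cancel, Real.exp_zero, one_mul]

/-- With symmetry, this allows two arbitrary points of the model to be compared through `p₀`. -/
theorem Compatible.trans {p q r : PosDensity μ} (h : Compatible p q) (h' : Compatible q r) :
    Compatible p r := by
  refine ⟨h.embeds.trans h'.embeds, h'.embeds_symm.trans h.embeds_symm, fun v hv => ?_,
    fun v hv => ?_, ?_⟩
  · rw [← ratioMul_trans r q p]
    exact h'.ratio _ (h.ratio v hv)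
  · rw [← ratioMul_trans p q r]
    exact h.ratio_symm _ (h'.ratio_symm v hv)
  · obtain ⟨L, hL, h1⟩ := h.log_mem
    obtain ⟨L', hL', h2⟩ := h'.log_mem
    refine ⟨L' + L, add_mem (h.embeds_symm.mem hL') hL, ?_⟩
    filter_upwards [h1, h2, AEEqFun.coeFn_add L' L] with x hx hx' ha
    rw [ha, hx', hx, Pi.add_apply, Real.exp_add, mul_assoc]

/-! ### Centred functions -/

/-- Centred functions that differ by a constant are equal. -/
theorem centered_ext {Φ : YoungFunction} {p : PosDensity μ} {u v : centered Φ p} {c : ℝ}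
    (h : ∀ᵐ x ∂μ, u.1.1 x = v.1.1 x + c) : u = v := by
  have hu : p.expect u.1.1 = 0 := u.2
  have hv : p.expect v.1.1 = 0 := v.2
  have h1 : p.expect u.1.1 = p.expect v.1.1 + c * p.expect (fun _ => 1) := by
    rw [p.expect_congr h]
    simp only [PosDensity.expect, add_mul, one_mul]
    rw [integral_add (integrable_mul_density v.1.2) (p.integrable.const_mul c),
      integral_const_mul]
  rw [hu, hv, p.expect_one] at h1
  have hc : c = 0 := by linarith
  refine Subtype.ext (Subtype.ext (AEEqFun.ext ?_))
  filter_upwards [h] with x hx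
  rw [hx, hc, add_zero]

theorem coeFn_center {p : PosDensity μ} {f : Ω →ₘ[μ] ℝ} (hf : f ∈ orlicz coshYoung p) :
    ∀ᵐ x ∂μ, (center p f).1.1 x = f x - p.expect f := by
  rw [center, dif_pos hf]
  filter_upwards [AEEqFun.coeFn_sub f (AEEqFun.const Ω (p.expect f)),
    AEEqFun.coeFn_const (α := Ω) (μ := μ) (p.expect f)] with x hx hc
  rw [Submodule.coe_sub, hx, Pi.sub_apply, hc, Function.const]

theorem coeFn_eTransport {p q : PosDensity μ} (h : Embeds p q) (v : B p) :
    ∀ᵐ x ∂μ, (eTransport p q v).1.1 x = v.1.1 x - q.expect v.1.1 :=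
  coeFn_center (h.mem v.1.2)

theorem eTransport_self (p : PosDensity μ) (v : B p) : eTransport p p v = v :=
  centered_ext (c := -p.expect v.1.1) (by
    filter_upwards [coeFn_center v.1.2] with x hx
    rw [eTransport, hx, sub_eq_add_neg])

/-- Both sides are `v` up to an additive constant and are centred at `r`, so the constants must
agree. -/
theorem eTransport_eTransport {p q r : PosDensity μ} (hpq : Embeds p q) (hqr : Embeds q r)
    (v : B p) : eTransport q r (eTransport p q v) = eTransport p r v :=
  centered_ext (c := -q.expect v.1.1 - r.expect (eTransport p q v).1.1 + r.expect v.1.1) (by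
    filter_upwards [coeFn_eTransport hqr (eTransport p q v), coeFn_eTransport hpq v,
      coeFn_eTransport (hpq.trans hqr) v] with x h1 h2 h3
    rw [h1, h2, h3]
    ring)

/-- Hölder against the constant `1` bounds the mean that is subtracted. -/
theorem norm_center_le {q : PosDensity μ} {f : Ω →ₘ[μ] ℝ} (hf : f ∈ orlicz coshYoung q) :
    ‖center q f‖ ≤ (1 + 2 * ‖(⟨_, const_mem_orlicz coshYoungConj q 1⟩ : orlicz coshYoungConj q)‖
      * ‖(⟨_, const_mem_orlicz coshYoung q 1⟩ : orlicz coshYoung q)‖)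
      * ‖(⟨f, hf⟩ : orlicz coshYoung q)‖ := by
  have h1 : |q.expect f| ≤ _ :=
    le_of_eq_of_le (congrArg _ (q.expect_congr ?_))
      (holder (⟨_, const_mem_orlicz coshYoungConj q 1⟩ : orlicz coshYoungConj q) ⟨f, hf⟩)
  · rw [center, dif_pos hf]
    have h2 : (⟨_, const_mem_orlicz coshYoung q (q.expect f)⟩ : orlicz coshYoung q)
        = q.expect f • ⟨_, const_mem_orlicz coshYoung q 1⟩ := by
      refine Subtype.ext (AEEqFun.ext ?_)
      filter_upwards [AEEqFun.coeFn_const (α := Ω) (μ := μ) (q.expect f),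
        AEEqFun.coeFn_const (α := Ω) (μ := μ) (1 : ℝ),
        AEEqFun.coeFn_smul (q.expect f) (AEEqFun.const Ω (1 : ℝ) : Ω →ₘ[μ] ℝ)] with x h1 h2 h3
      rw [Submodule.coe_smul, h1, h3, Pi.smul_apply, h2]
      simp
    refine (norm_sub_le (⟨f, hf⟩ : orlicz coshYoung q) _).trans ?_
    rw [h2, norm_smul, Real.norm_eq_abs]
    have := mul_le_mul_of_nonneg_right h1
      (norm_nonneg (⟨_, const_mem_orlicz coshYoung q 1⟩ : orlicz coshYoung q))
    linarith
  · filter_upwards [AEEqFun.coeFn_const (α := Ω) (μ := μ) (1 : ℝ)] with x hx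
    simp [hx]

/-- The exponential transport is continuous and linear. -/
theorem exists_eTransportL {p q : PosDensity μ} (h : Embeds p q) :
    ∃ T : B p →L[ℝ] B q, ∀ v, T v = eTransport p q v := by
  have hadd : ∀ v w : B p, eTransport p q (v + w) = eTransport p q v + eTransport p q w :=
    fun v w => centered_ext (c := q.expect v.1.1 + q.expect w.1.1 - q.expect (v + w).1.1) (by
      filter_upwards [coeFn_eTransport h v, coeFn_eTransport h w, coeFn_eTransport h (v + w),
        AEEqFun.coeFn_add v.1.1 w.1.1,
        AEEqFun.coeFn_add (eTransport p q v).1.1 (eTransport p q w).1.1] with x h1 h2 h3 h4 h5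
      rw [h3]
      simp only [Submodule.coe_add]
      rw [h4, h5, Pi.add_apply, Pi.add_apply, h1, h2]
      ring)
  have hsmul : ∀ (c : ℝ) (v : B p), eTransport p q (c • v) = c • eTransport p q v :=
    fun c v => centered_ext (c := c * q.expect v.1.1 - q.expect (c • v).1.1) (by
      filter_upwards [coeFn_eTransport h v, coeFn_eTransport h (c • v),
        AEEqFun.coeFn_smul c v.1.1,
        AEEqFun.coeFn_smul c (eTransport p q v).1.1] with x h1 h2 h3 h4
      rw [h2]
      simp only [Submodule.coe_smul]
      rw [h3, h4, Pi.smul_apply, Pi.smul_apply, h1, smul_eq_mul, smul_eq_mul]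
      ring)
  obtain ⟨C, hC, hb⟩ := h
  refine ⟨LinearMap.mkContinuous
    { toFun := eTransport p q, map_add' := hadd, map_smul' := hsmul }
    ((1 + 2 * ‖(⟨_, const_mem_orlicz coshYoungConj q 1⟩ : orlicz coshYoungConj q)‖
      * ‖(⟨_, const_mem_orlicz coshYoung q 1⟩ : orlicz coshYoung q)‖) * C) fun v => ?_,
    fun v => rfl⟩
  obtain ⟨h1, h2⟩ := hb v.1
  refine (norm_center_le h1).trans ?_
  exact (mul_le_mul_of_nonneg_left h2 (by positivity)).trans_eq (mul_assoc _ _ _).symm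

/-! ### Mixture transport and coupling -/

theorem coeFn_mTransport {p q : PosDensity μ} (h : Compatible p q) (v : preB p) :
    ∀ᵐ x ∂μ, (mTransport p q v).1.1 x = p x / q x * v.1.1 x := by
  rw [mTransport, dif_pos (h.ratio _ v.1.2)]
  exact coeFn_ratioMul p q v.1.1

theorem mTransport_self (p : PosDensity μ) (v : preB p) (h : Compatible p p) :
    mTransport p p v = v :=
  centered_ext (c := 0) (by
    filter_upwards [coeFn_mTransport h v, p.pos] with x hx hp
    rw [hx, div_self hp.ne', one_mul, add_zero])

/-- The transports are dual to each other. -/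
theorem coupling_transport {p q : PosDensity μ} (h : Compatible q p) (v : preB q) (w : B q) :
    coupling p (mTransport q p v) (eTransport q p w) = coupling q v w := by
  -- This kills the contribution of the constant `E_p[w]` subtracted by the exponential transport.
  have hv : q.expect v.1.1 = 0 := v.2
  have h1 : coupling p (mTransport q p v) (eTransport q p w)
      = ∫ x, (v.1.1 x * w.1.1 x * q x - p.expect w.1.1 * (v.1.1 x * q x)) ∂μ := by
    refine integral_congr_ae ?_
    filter_upwards [coeFn_mTransport h v, coeFn_eTransport h.embeds w, p.pos] with x h1 h2 hp
    rw [h1, h2]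
    field_simp
  rw [h1, integral_sub (integrable_mul_mul_density v.1 w.1)
    ((integrable_mul_density v.1.2).const_mul _), integral_const_mul]
  change _ - _ * q.expect v.1.1 = _
  rw [hv, mul_zero, sub_zero]
  rfl

/-! ### Charts -/

theorem cumulant_lt_top_iff {p : PosDensity μ} {u : B p} :
    cumulant p u < ⊤ ↔ p.lexpect (fun x => Real.exp (u.1.1 x)) < ∞ := by
  rw [cumulant, ENNReal.log_lt_top_iff]

theorem coeFn_e {p : PosDensity μ} {u : B p} (hu : cumulant p u < ⊤) :
    ∀ᵐ x ∂μ, e p u x = Real.exp (u.1.1 x - (cumulant p u).toReal) * p x := by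
  rw [e, dif_pos hu]
  exact AEEqFun.coeFn_mk _ _

/-- If `q` is proportional to `e^u p` then `K_p(u) < ∞` and `q = e_p(u)`. -/
theorem e_eq_of_ae {p q : PosDensity μ} {u : B p} {k : ℝ}
    (h : ∀ᵐ x ∂μ, q x = Real.exp (u.1.1 x - k) * p x) :
    cumulant p u < ⊤ ∧ e p u = q := by
  have hu : cumulant p u < ⊤ := by
    rw [cumulant_lt_top_iff]
    have h1 : p.lexpect (fun x => Real.exp (u.1.1 x)) = q.lexpect fun _ => Real.exp k := by
      rw [PosDensity.lexpect_tilt h]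
      congr 1
      ext x
      rw [← Real.exp_add, sub_add_cancel]
    rw [h1, PosDensity.lexpect_const]
    exact ENNReal.ofReal_lt_top
  refine ⟨hu, PosDensity.ext_of_ae_mul (c := Real.exp (k - (cumulant p u).toReal)) ?_⟩
  filter_upwards [h, coeFn_e hu] with x h1 h2
  rw [h1, h2, ← mul_assoc, ← Real.exp_add]
  congr 2
  ring

/-- Membership of the log-ratio in `L^Φ(p)` is essential: elsewhere `center` takes its default value
`0`. -/
theorem coeFn_s {p q : PosDensity μ} {L : Ω →ₘ[μ] ℝ} (hL : L ∈ orlicz coshYoung p)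
    (h : ∀ᵐ x ∂μ, q x = Real.exp (L x) * p x) :
    ∀ᵐ x ∂μ, (s p q).1.1 x = L x - p.expect L := by
  have : AEEqFun.mk (fun x => Real.log (q x / p x)) (Real.measurable_log.comp_aemeasurable
      (q.aemeasurable.div p.aemeasurable)).aestronglyMeasurable = L := by
    refine AEEqFun.ext ?_
    filter_upwards [h, p.pos, AEEqFun.coeFn_mk (μ := μ) (fun x => Real.log (q x / p x))
      (Real.measurable_log.comp_aemeasurable
        (q.aemeasurable.div p.aemeasurable)).aestronglyMeasurable] with x hx hp hm
    rw [hm, hx, mul_div_cancel_right₀ _ hp.ne', Real.log_exp]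
  rw [s, this]
  exact coeFn_center hL

/-- The chart at `p` is the affine chart change applied to the chart at `r`. -/
theorem e_affine {p r : PosDensity μ} (h : Compatible p r) {u : B r} (hu : cumulant r u < ⊤) :
    cumulant p (eTransport r p u + s p r) < ⊤ ∧ e p (eTransport r p u + s p r) = e r u := by
  obtain ⟨L, hL, h1⟩ := h.log_mem
  -- Here `e_r(u) = e^{u - K_r(u) + L} p`; the two means are those removed by centring `u` and `L`
  -- at `p`.
  refine e_eq_of_ae (k := (cumulant r u).toReal - p.expect u.1.1 - p.expect L) ?_
  filter_upwards [h1, coeFn_s hL h1, coeFn_e hu, coeFn_eTransport h.embeds_symm u,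
    AEEqFun.coeFn_add (eTransport r p u).1.1 (s p r).1.1] with x h1 h2 h3 h4 h5
  simp only [Submodule.coe_add]
  rw [h5, Pi.add_apply, h2, h3, h4, h1, ← mul_assoc, ← Real.exp_add]
  congr 2
  ring

/-- Up to constants the round trip adds `log (p/r) + log (r/p) = 0`. Thus the two chart changes are
mutually inverse. -/
theorem affine_affine {p r : PosDensity μ} (h : Compatible p r) (w : B p) :
    eTransport r p (eTransport p r w + s r p) + s p r = w := by
  obtain ⟨L, hL, h1⟩ := h.log_mem
  obtain ⟨L', hL', h1'⟩ := h.symm.log_mem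
  refine centered_ext (c := - r.expect w.1.1 - r.expect L'
    - p.expect (eTransport p r w + s r p).1.1 - p.expect L) ?_
  filter_upwards [h1, coeFn_s hL h1, h1', coeFn_s hL' h1', p.pos,
    coeFn_eTransport h.embeds_symm (eTransport p r w + s r p),
    coeFn_eTransport h.embeds w,
    AEEqFun.coeFn_add (eTransport p r w).1.1 (s r p).1.1,
    AEEqFun.coeFn_add (eTransport r p (eTransport p r w + s r p)).1.1 (s p r).1.1]
    with x h1 h2 h3 h4 hp h5 h6 h7 h8
  have h9 : L' x + L x = 0 := by
    rw [h1, ← mul_assoc, ← Real.exp_add] at h3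
    have h10 : Real.exp (L' x + L x) = 1 := by
      have := hp.ne'
      field_simp at h3
      exact h3.symm
    exact (Real.exp_eq_one_iff _).1 h10
  rw [show ((eTransport r p (eTransport p r w + s r p) + s p r : B p)).1.1 x
    = (eTransport r p (eTransport p r w + s r p)).1.1 x + (s p r).1.1 x from h8, h5,
    show (eTransport p r w + s r p).1.1 x = (eTransport p r w).1.1 x + (s r p).1.1 x from h7,
    h6, h2, h4]
  linear_combination h9

theorem continuous_affine {p r : PosDensity μ} (h : Compatible p r) :
    Continuous fun w : B p => eTransport p r w + s r p := by
  obtain ⟨T, hT⟩ := exists_eTransportL h.embeds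
  simp only [← hT]
  exact T.continuous.add continuous_const

theorem cumulant_lt_top_of_mem {p : PosDensity μ} {u : B p} (hu : u ∈ chartDomain p) :
    cumulant p u < ⊤ :=
  interior_subset (s := {u | cumulant p u < ⊤}) hu

/-- The preimage of the domain at `r` under the continuous inverse chart change is open, and
`e_affine` puts it inside the proper domain of `K_p`, hence inside its interior. -/
theorem affine_mem_chartDomain {p r : PosDensity μ} (h : Compatible p r) {u : B r}
    (hu : u ∈ chartDomain r) : eTransport r p u + s p r ∈ chartDomain p := by
  refine mem_interior.2 ⟨(fun w : B p => eTransport p r w + s r p) ⁻¹' chartDomain r, ?_,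
    isOpen_interior.preimage (continuous_affine h), ?_⟩
  · intro w hw
    have := (e_affine h (cumulant_lt_top_of_mem hw)).1
    rwa [affine_affine h] at this
  · rw [mem_preimage, affine_affine h.symm]
    exact hu

/-- Here `log (e_p(u)/p) = u - K_p(u)`, and centring removes the constant. -/
theorem s_e {p : PosDensity μ} {u : B p} (hu : cumulant p u < ⊤) : s p (e p u) = u := by
  have hc := const_mem_orlicz coshYoung p (cumulant p u).toReal
  have hx : ∀ᵐ x ∂μ, (u.1.1 - AEEqFun.const Ω (cumulant p u).toReal : Ω →ₘ[μ] ℝ) x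
      = u.1.1 x - (cumulant p u).toReal := by
    filter_upwards [AEEqFun.coeFn_sub u.1.1 (AEEqFun.const Ω (cumulant p u).toReal),
      AEEqFun.coeFn_const (α := Ω) (μ := μ) (cumulant p u).toReal] with x h1 h2
    rw [h1, Pi.sub_apply, h2, Function.const]
  refine centered_ext (c := -(cumulant p u).toReal - p.expect
    (u.1.1 - AEEqFun.const Ω (cumulant p u).toReal : Ω →ₘ[μ] ℝ)) ?_
  filter_upwards [hx, coeFn_s (sub_mem u.1.2 hc) (q := e p u) (by
    filter_upwards [hx, coeFn_e hu] with x h1 h2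
    rw [h1, h2])] with x h1 h2
  rw [h2, h1]
  ring

/-- Both tilt bounds hold, for different reasons: one because `u` is interior to the proper domain,
the other because `u` lies in `L^Φ(p)`. -/
theorem Compatible.of_mem_maxExp {p q : PosDensity μ} (hq : q ∈ maxExp p) : Compatible p q := by
  obtain ⟨u, hu, rfl⟩ := hq
  have hfin := cumulant_lt_top_of_mem hu
  set k := (cumulant p u).toReal with hk
  have he := coeFn_e hfin
  have hum : AEMeasurable (fun x => u.1.1 x) μ := u.1.1.aemeasurable
  have h1 : TiltBound p (e p u) := by
    -- Openness of the domain leaves room to stretch `u` slightly beyond itself.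
    obtain ⟨ε, hε, hmem⟩ : ∃ ε : ℝ, 0 < ε ∧ cumulant p ((1 + ε) • u) < ⊤ := by
      have hc : ContinuousAt (fun ε : ℝ => (1 + ε) • u) 0 := by fun_prop
      have hn : chartDomain p ∈ nhds ((1 + (0 : ℝ)) • u) := by
        rw [add_zero, one_smul]
        exact isOpen_interior.mem_nhds hu
      obtain ⟨δ, hδ, hb⟩ := Metric.mem_nhds_iff.1 (hc hn)
      refine ⟨δ / 2, by positivity, cumulant_lt_top_of_mem (hb ?_)⟩
      rw [Metric.mem_ball, dist_zero_right, Real.norm_of_nonneg (by positivity)]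
      linarith
    refine ⟨fun x => u.1.1 x - k, hum.sub_const _, he, ε, hε, ?_⟩
    rw [cumulant_lt_top_iff] at hmem
    refine lt_of_eq_of_lt ?_ (ENNReal.mul_lt_top
      (ENNReal.ofReal_lt_top (r := Real.exp (-((1 + ε) * k)))) hmem)
    rw [← p.lexpect_smul (Real.exp_pos _).le]
    refine p.lexpect_congr ?_
    filter_upwards [AEEqFun.coeFn_smul (1 + ε) u.1.1] with x hx
    rw [Submodule.coe_smul, Submodule.coe_smul, hx, Pi.smul_apply, smul_eq_mul, ← Real.exp_add]
    congr 1
    ring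
  -- Up to a constant factor `E_q[(p/q)^(1+α)]` is `E_p[e^{-αu}]`, dominated by `2 E_p[cosh (α u)]`,
  -- so the Orlicz exponent `α` of `u` serves as `ε`.
  have h2 : TiltBound (e p u) p := by
    obtain ⟨α, hα, hmem⟩ := u.1.2
    refine ⟨fun x => -(u.1.1 x - k), (hum.sub_const _).neg, ?_, α, hα, ?_⟩
    · filter_upwards [he] with x hx
      rw [hx, ← mul_assoc, ← Real.exp_add, neg_add_cancel, Real.exp_zero, one_mul]
    rw [PosDensity.lexpect_tilt he]
    have hcm : AEMeasurable (fun x => coshYoung (α * u.1.1 x)) μ :=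
      coshYoung.continuous.measurable.comp_aemeasurable (hum.const_mul _)
    refine lt_of_le_of_lt (b := p.lexpect (fun x =>
      (2 * Real.exp (α * k)) * coshYoung (α * u.1.1 x) + 1 * (2 * Real.exp (α * k)))) ?_ ?_
    · refine p.lexpect_mono fun x => ?_
      rw [← Real.exp_add, show u.1.1 x - k + (1 + α) * -(u.1.1 x - k)
        = α * k + -(α * u.1.1 x) by ring, Real.exp_add, coshYoung_apply, Real.cosh_eq]
      have := mul_pos (Real.exp_pos (α * k)) (Real.exp_pos (α * u.1.1 x))
      linarith
    · rw [p.lexpect_comb hcm (fun _ => coshYoung.nonneg _) (fun _ => by positivity)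
        (by positivity) zero_le_one, PosDensity.lexpect_const]
      exact ENNReal.add_lt_top.2 ⟨ENNReal.mul_lt_top ENNReal.ofReal_lt_top hmem,
        ENNReal.mul_lt_top ENNReal.ofReal_lt_top ENNReal.ofReal_lt_top⟩
  refine ⟨h1.embeds, h2.embeds, fun v hv => h2.ratioMul_mem hv, fun v hv => h1.ratioMul_mem hv,
    u.1.1 - AEEqFun.const Ω k, sub_mem u.1.2 (const_mem_orlicz coshYoung p k), ?_⟩
  filter_upwards [he, AEEqFun.coeFn_sub u.1.1 (AEEqFun.const Ω k),
    AEEqFun.coeFn_const (α := Ω) (μ := μ) k] with x h1 h2 h3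
  rw [h1, h2, Pi.sub_apply, h3, Function.const]

/-! ### The atlas of a maximal exponential model -/

section Model

variable {p₀ p q r : PosDensity μ}

theorem compatible_of_mem (hp : p ∈ maxExp p₀) (hq : q ∈ maxExp p₀) : Compatible p q :=
  (Compatible.of_mem_maxExp hp).symm.trans (Compatible.of_mem_maxExp hq)

/-- The coordinate of `q` at `p₀`, moved by the affine change, lies in the domain at `p` and
represents `q`; `s_e` identifies it with `s p q`. -/
theorem s_mem_and_e_s (hp : p ∈ maxExp p₀) (hq : q ∈ maxExp p₀) :
    s p q ∈ chartDomain p ∧ e p (s p q) = q := by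
  have hc := (Compatible.of_mem_maxExp hp).symm
  obtain ⟨u, hu, rfl⟩ := hq
  have h1 := affine_mem_chartDomain hc hu
  have h2 := (e_affine hc (cumulant_lt_top_of_mem hu)).2
  have h3 := s_e (cumulant_lt_top_of_mem h1)
  rw [h2] at h3
  rw [← h3] at h1 h2
  exact ⟨h1, h2⟩

theorem e_mem_maxExp (hp : p ∈ maxExp p₀) {u : B p} (hu : u ∈ chartDomain p) :
    e p u ∈ maxExp p₀ := by
  have hc := Compatible.of_mem_maxExp hp
  exact ⟨_, affine_mem_chartDomain hc hu, (e_affine hc (cumulant_lt_top_of_mem hu)).2⟩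

/-- The chart change from `p` to itself is translation by `s p p` and is its own inverse. -/
theorem s_self (hp : p ∈ maxExp p₀) : s p p = 0 := by
  obtain ⟨h1, h2⟩ := s_mem_and_e_s hp hp
  have h : Compatible p p := compatible_of_mem hp hp
  have h3 := affine_affine h (0 : B p)
  rw [eTransport_self, eTransport_self, zero_add] at h3
  have h4 : (2 : ℝ) • s p p = 0 := by rw [two_smul]; exact h3
  exact (smul_eq_zero.1 h4).resolve_left two_ne_zero

/-- The representation of `⟨F, G⟩` in the chart at `p` is the coupling of the representations. -/
theorem coupling_rep (hp : p ∈ maxExp p₀) (F : ∀ q : PosDensity μ, preB q)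
    (G : ∀ q : PosDensity μ, B q) {u : B p} (hu : u ∈ chartDomain p) :
    coupling (e p u) (F (e p u)) (G (e p u)) = couplingL p (mRep p F u) (eRep p G u) :=
  (coupling_transport (compatible_of_mem (e_mem_maxExp hp hu) hp) _ _).symm

theorem isC1Fun_coupling {F : ∀ q : PosDensity μ, preB q} {G : ∀ q : PosDensity μ, B q}
    (hF : IsC1Pretangent (maxExp p₀) F) (hG : IsC1Tangent (maxExp p₀) G) :
    IsC1Fun (maxExp p₀) fun q => coupling q (F q) (G q) := fun p hp =>
  (((couplingL p).isBoundedBilinearMap.contDiff (n := 1)).comp_contDiffOn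
    ((hF p hp).prodMk (hG p hp))).congr fun _ hu => coupling_rep hp F G hu

/-! ### Covariant derivatives and independence of the chart -/

theorem differentiableAt_of_contDiffOn {X : Type*} [NormedAddCommGroup X] [NormedSpace ℝ X]
    {f : B p → X} (hf : ContDiffOn ℝ 1 f (chartDomain p)) {u : B p} (hu : u ∈ chartDomain p) :
    DifferentiableAt ℝ f u :=
  (hf.differentiableOn one_ne_zero).differentiableAt (isOpen_interior.mem_nhds hu)

/-- Near `s_p(q)`, the chart at `p` is the chart at `q` after the affine chart change, which has
the exponential transport as its derivative. -/
theorem hasFDerivAt_comp_affine {X : Type*} [NormedAddCommGroup X] [NormedSpace ℝ X]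
    (hp : p ∈ maxExp p₀) (hq : q ∈ maxExp p₀) {T : B p →L[ℝ] B q}
    (hT : ∀ v, T v = eTransport p q v) {f : B q → X} (hf : DifferentiableAt ℝ f 0) :
    HasFDerivAt (fun w : B p => f (eTransport p q w + s q p)) ((fderiv ℝ f 0).comp T)
      (s p q) := by
  have hc := compatible_of_mem hq hp
  have h0 : eTransport p q (s p q) + s q p = 0 := by
    have := affine_affine hc (0 : B q)
    rwa [show eTransport q p (0 : B q) = 0 by
      obtain ⟨S, hS⟩ := exists_eTransportL hc.embeds
      rw [← hS, map_zero], zero_add] at this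
  have hA : HasFDerivAt (fun w : B p => eTransport p q w + s q p) T (s p q) := by
    simp only [← hT]
    exact T.hasFDerivAt.add_const _
  refine HasFDerivAt.comp (s p q) ?_ hA
  rw [h0]
  exact hf.hasFDerivAt

theorem zero_mem_chartDomain (hq : q ∈ maxExp p₀) : (0 : B q) ∈ chartDomain q ∧ e q 0 = q := by
  have := s_mem_and_e_s hq hq
  rwa [s_self hq] at this

/-- By the chain rule the derivative at `s p q` is the derivative at `0` in the chart at `q` after
transport from `p` to `q`, which undoes the transport of `H q`. -/
theorem covDerivFun_eq (hp : p ∈ maxExp p₀) (hq : q ∈ maxExp p₀) (H : ∀ q : PosDensity μ, B q)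
    {E : PosDensity μ → ℝ} (hE : IsC1Fun (maxExp p₀) E) :
    covDerivFun p H E q = fderiv ℝ (fun u => E (e q u)) 0 (H q) := by
  have hc := compatible_of_mem hp hq
  obtain ⟨T, hT⟩ := exists_eTransportL hc.embeds
  have h1 := hasFDerivAt_comp_affine hp hq hT
    (differentiableAt_of_contDiffOn (hE q hq) (zero_mem_chartDomain hq).1)
  have h2 : (fun u => E (e p u)) =ᶠ[nhds (s p q)]
      fun w => E (e q (eTransport p q w + s q p)) := by
    filter_upwards [isOpen_interior.mem_nhds (s_mem_and_e_s hp hq).1] with w hw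
    rw [(e_affine hc.symm (cumulant_lt_top_of_mem hw)).2]
  rw [covDerivFun, (h1.congr_of_eventuallyEq h2).fderiv, ContinuousLinearMap.comp_apply, hT,
    eTransport_eTransport hc.embeds_symm hc.embeds, eTransport_self]

/-- Near `s r q` the representation at `r` is the one at `q`, precomposed with the chart change and
followed by transport from `q` to `r`. After differentiation both pairs of opposite transports
cancel. -/
theorem covDerivTangent_eq (hr : r ∈ maxExp p₀) (hq : q ∈ maxExp p₀)
    (H : ∀ q : PosDensity μ, B q) {G : ∀ q : PosDensity μ, B q}
    (hG : IsC1Tangent (maxExp p₀) G) :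
    covDerivTangent r H G q = fderiv ℝ (eRep q G) 0 (H q) := by
  have hc := compatible_of_mem hr hq
  obtain ⟨T, hT⟩ := exists_eTransportL hc.embeds
  obtain ⟨S, hS⟩ := exists_eTransportL hc.embeds_symm
  have h1 := S.hasFDerivAt.comp (s r q) (hasFDerivAt_comp_affine hr hq hT
    (differentiableAt_of_contDiffOn (hG q hq) (zero_mem_chartDomain hq).1))
  have h2 : eRep r G =ᶠ[nhds (s r q)]
      S ∘ fun w => eRep q G (eTransport r q w + s q r) := by
    filter_upwards [isOpen_interior.mem_nhds (s_mem_and_e_s hr hq).1] with w hw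
    have hm := e_mem_maxExp hr hw
    rw [Function.comp_apply, hS, eRep, eRep, (e_affine hc.symm (cumulant_lt_top_of_mem hw)).2,
      eTransport_eTransport (compatible_of_mem hm hq).embeds hc.embeds_symm]
  rw [covDerivTangent, (h1.congr_of_eventuallyEq h2).fderiv, ContinuousLinearMap.comp_apply,
    ContinuousLinearMap.comp_apply, hT, hS,
    eTransport_eTransport hc.embeds_symm hc.embeds, eTransport_self,
    eTransport_eTransport hc.embeds_symm hc.embeds, eTransport_self]

theorem eRep_zero (hq : q ∈ maxExp p₀) (G : ∀ q : PosDensity μ, B q) : eRep q G 0 = G q := by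
  rw [eRep, (zero_mem_chartDomain hq).2, eTransport_self]

theorem mRep_zero (hq : q ∈ maxExp p₀) (F : ∀ q : PosDensity μ, preB q) :
    mRep q F 0 = F q := by
  rw [mRep, (zero_mem_chartDomain hq).2, mTransport_self _ _ (compatible_of_mem hq hq)]

theorem covDerivFun_coupling (hp : p ∈ maxExp p₀) (hr : r ∈ maxExp p₀) (hq : q ∈ maxExp p₀)
    {F : ∀ q : PosDensity μ, preB q} {G : ∀ q : PosDensity μ, B q}
    (H : ∀ q : PosDensity μ, B q)
    (hF : IsC1Pretangent (maxExp p₀) F) (hG : IsC1Tangent (maxExp p₀) G) :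
    covDerivFun p H (fun q => coupling q (F q) (G q)) q =
      coupling q (covDerivPretangent H F q) (G q) + coupling q (F q) (covDerivTangent r H G q) := by
  have h0 := (zero_mem_chartDomain hq).1
  have hE : (fun u => coupling (e q u) (F (e q u)) (G (e q u))) =ᶠ[nhds 0]
      fun u => couplingL q (mRep q F u) (eRep q G u) := by
    filter_upwards [isOpen_interior.mem_nhds h0] with u hu
    exact coupling_rep hq F G hu
  -- Leibniz rule at `0`, where both representations take the values of the fields at `q`. Its two
  -- terms come in the opposite order, hence the `add_comm` below.
  have hd := (couplingL q).hasFDerivAt_of_bilinear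
    (differentiableAt_of_contDiffOn (hF q hq) h0).hasFDerivAt
    (differentiableAt_of_contDiffOn (hG q hq) h0).hasFDerivAt
  rw [covDerivFun_eq hp hq H (isC1Fun_coupling hF hG), covDerivTangent_eq hr hq H hG,
    covDerivPretangent, (hd.congr_of_eventuallyEq hE).fderiv, eRep_zero hq, mRep_zero hq, add_comm]
  rfl

end Model

end ExpManifold

theorem mainTheorem5 {Ω : Type*} [MeasurableSpace Ω] (μ : MeasureTheory.Measure Ω)
    [MeasureTheory.SigmaFinite μ]
    (p₀ : ExpManifold.PosDensity μ) (ℰ : Set (ExpManifold.PosDensity μ))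
    (hℰ : ℰ = ExpManifold.maxExp p₀)
    (F : ∀ q : ExpManifold.PosDensity μ, ExpManifold.preB q)
    (G H : ∀ q : ExpManifold.PosDensity μ, ExpManifold.B q)
    (hF : ExpManifold.IsC1Pretangent ℰ F)
    (hG : ExpManifold.IsC1Tangent ℰ G)
    (hH : ExpManifold.IsC1Tangent ℰ H) :
    ExpManifold.IsC1Fun ℰ (fun q => ExpManifold.coupling q (F q) (G q)) ∧
    ∀ p ∈ ℰ, ∀ r ∈ ℰ, ∀ q ∈ ℰ,
      ExpManifold.covDerivFun p H (fun q => ExpManifold.coupling q (F q) (G q)) q =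
        ExpManifold.coupling q (ExpManifold.covDerivPretangent H F q) (G q) +
        ExpManifold.coupling q (F q) (ExpManifold.covDerivTangent r H G q) := by
  subst hℰ
  exact ⟨ExpManifold.isC1Fun_coupling hF hG, fun p hp r hr q hq =>
    ExpManifold.covDerivFun_coupling hp hr hq H hF hG⟩
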